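/- Let $W$ be a set, $\mathcal U$ an ultrafilter on $W$, and for each $w\in W$ let $R_w$ be a Noetherian local ring. Assume that for some $m\in\mathbb N$ the embedding dimension of $R_w$ is at most $m$ for almost all $w$ (that is, for all $w$ in a set belonging to $\mathcal U$). Let $R$ be a ring isomorphic to the ultraproduct of the $R_w$ with respect to $\mathcal U$; it is a local ring, with maximal ideal $\mathfrak m$, say. Then there is a natural number $h$, the ultra-dimension $\operatorname{ultra-dim}(R)$ of $R$, such that $R_w$ has Krull dimension $h$ for almost all $w$, and $$\operatorname{depth}(R)\le\operatorname{pi-dim}(R)=\operatorname{fr-dim}(R)=\operatorname{ultra-dim}(R)\le\operatorname{cl-dim}(R)=\operatorname{pseudo-dim}(R)=\operatorname{cata-dim}(R)\le\operatorname{embdim}(R).$$ Here the invariants are defined as follows (a least number is $\infty$ if there is none). - A prime ideal $\mathfrak p$ is an associated prime of an ideal $J$ if $\mathfrak p=(J:a)$ for some $a\in R$; it is a minimal associated prime of $J$ if moreover no associated prime of $J$ is properly contained in $\mathfrak p$. - $\operatorname{depth}(R)$ is the grade of $\mathfrak m$: for any finite tuple $x=(x_1,\dots,x_n)$ generating $\mathfrak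 m$, it is $n-i$, where $i$ is the largest index for which the Koszul homology $H_i(x;R)$ is non-zero (this does not depend on the choice of $x$). - $\operatorname{pi-dim}(R)$ is the least $d$ such that $\mathfrak m$ is a minimal associated prime of an ideal generated by $d$ elements. - $\operatorname{fr-dim}(R)$ is the supremum of the lengths of chains of prime ideals of $R$ each of which is an associated prime of some finitely generated ideal. - $\operatorname{cl-dim}(R)$ is the supremum of the lengths of chains of closed prime ideals of $R$, an ideal $I$ being closed if $I=\bigcap_n(I+\mathfrak m^n)$. - $\operatorname{pseudo-dim}(R)$ is defined recursively for local rings: it is at most $0$ if and only if the ring is Artinian, it is at most $d+1$ if and only if there is $x$ in the maximal ideal such that the residue ring modulo $x$ has pseudo-dimension at most $d$, and it is the least $d$ for which it is at most $d$. - $\operatorname{cata-dim}(R)$ is the Krull dimension of the completion $\widehat R=\varprojlim_n R/\mathfrak m^n$. - $\operatorname{embdim}(R)$ is the least number of generators of $\mathfrak m$. -/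

import Mathlib

open Filter

noncomputable section

namespace UltraNoeth

universe u v

/-! ### Ultraproducts of rings -/

section Ultraproduct

variable {W : Type u}

/-- The ideal of the product `∏ R_w` of all families that vanish for almost all `w`. -/
def almostZero (U : Ultrafilter W) (R : W → Type v) [∀ w, CommRing (R w)] :
    Ideal (∀ w, R w) where
  carrier := {f | ∀ᶠ w in (U : Filter W), f w = 0}
  add_mem' := by
    intro f g hf hg
    filter_upwards [hf, hg] with w h1 h2
    simp [h1, h2]
  zero_mem' := Eventually.of_forall fun _ => rfl
  smul_mem' := by
    intro c f hf
    filter_upwards [hf] with w h1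
    simp [h1]

theorem mem_almostZero {U : Ultrafilter W} {R : W → Type v} [∀ w, CommRing (R w)]
    {f : ∀ w, R w} : f ∈ almostZero U R ↔ ∀ᶠ w in (U : Filter W), f w = 0 := Iff.rfl

/-- The ultraproduct of the rings `R w`: families of elements, two families being identified
when they agree for almost all `w`. -/
abbrev Ultraproduct (U : Ultrafilter W) (R : W → Type v) [∀ w, CommRing (R w)] :
    Type (max u v) :=
  (∀ w, R w) ⧸ almostZero U R

/-- An ultraproduct of local rings is a local ring. -/
instance isLocalRing_ultraproduct (U : Ultrafilter W) (R : W → Type v)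
    [∀ w, CommRing (R w)] [∀ w, IsLocalRing (R w)] : IsLocalRing (Ultraproduct U R) := by
  have key : ∀ f : ∀ w, R w, (∀ᶠ w in (U : Filter W), IsUnit (f w)) →
      IsUnit (Ideal.Quotient.mk (almostZero U R) f) := by
    intro f hf
    refine IsUnit.of_mul_eq_one (Ideal.Quotient.mk (almostZero U R) fun w => Ring.inverse (f w)) ?_
    rw [← map_mul, ← map_one (Ideal.Quotient.mk (almostZero U R)), Ideal.Quotient.eq,
      mem_almostZero]
    filter_upwards [hf] with w hw
    simp [Ring.mul_inverse_cancel _ hw]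
  have : Nontrivial (Ultraproduct U R) := by
    refine Ideal.Quotient.nontrivial_iff.mpr ?_
    rw [Ne, Ideal.eq_top_iff_one, mem_almostZero]
    intro h
    obtain ⟨w, hw⟩ := h.exists
    exact one_ne_zero hw
  refine IsLocalRing.of_isUnit_or_isUnit_one_sub_self fun a => ?_
  obtain ⟨f, rfl⟩ := Ideal.Quotient.mk_surjective a
  have hor : ∀ᶠ w in (U : Filter W), IsUnit (f w) ∨ IsUnit (1 - f w) :=
    Eventually.of_forall fun w => IsLocalRing.isUnit_or_isUnit_one_sub_self (f w)
  rcases Ultrafilter.eventually_or.mp hor with h | h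
  · exact Or.inl (key f h)
  · right
    rw [← map_one (Ideal.Quotient.mk (almostZero U R)), ← map_sub]
    exact key (1 - f) h

end Ultraproduct

/-! ### Embedding dimension and pseudo-dimension -/

/-- The embedding dimension of a local ring: the least number of generators of its maximal
ideal (`⊤` if the maximal ideal is not finitely generated). -/
def embDim (R : Type u) [CommRing R] [IsLocalRing R] : ℕ∞ :=
  ⨅ (n : ℕ) (_ : ∃ x : Fin n → R, Ideal.span (Set.range x) = IsLocalRing.maximalIdeal R), (n : ℕ∞)

/-- `PseudoDimLE d R`: the pseudo-dimension of the local ring `R` is at most `d`. It is at most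
`0` when `R` is Artinian, and at most `d + 1` when `R / xR` has pseudo-dimension at most `d` for
some non-unit `x` (that is, for some `x` in the maximal ideal). -/
def PseudoDimLE : ℕ → ∀ (R : Type u) [CommRing R], Prop
  | 0, R, _ => IsArtinianRing R
  | d + 1, R, _ => ∃ x ∈ nonunits R, PseudoDimLE d (R ⧸ Ideal.span {x})

/-- The pseudo-dimension of a local ring (`⊤` if there is no bound). -/
def pseudoDim (R : Type u) [CommRing R] : ℕ∞ :=
  ⨅ (d : ℕ) (_ : PseudoDimLE d R), (d : ℕ∞)

/-! ### Cata-dimension and cl-dimension -/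

/-- The cata-dimension of a local ring: the Krull dimension of its completion with respect to
the powers of the maximal ideal. -/
def cataDim (R : Type u) [CommRing R] [IsLocalRing R] : WithBot ℕ∞ :=
  ringKrullDim (AdicCompletion (IsLocalRing.maximalIdeal R) R)

/-- An ideal `I` of a local ring with maximal ideal `𝔪` is closed (in the `𝔪`-adic topology) if
it is the intersection of all `I + 𝔪 ^ n`. -/
def IsClosedIdeal {R : Type u} [CommRing R] [IsLocalRing R] (I : Ideal R) : Prop :=
  I = ⨅ n : ℕ, I ⊔ IsLocalRing.maximalIdeal R ^ n

/-- The cl-dimension of a local ring: the supremum of the lengths of the chains of closed prime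
ideals. -/
def clDim (R : Type u) [CommRing R] [IsLocalRing R] : WithBot ℕ∞ :=
  Order.krullDim {p : PrimeSpectrum R // IsClosedIdeal p.asIdeal}

/-! ### Fr-dimension and pi-dimension -/

/-- The prime ideal `p` is associated to the ideal `J` if `p = (J : a)` for some `a`. (No
radical is taken, unlike in Mathlib's `IsAssociatedPrime`.) -/
def IsAssocPrime {R : Type u} [CommRing R] (p J : Ideal R) : Prop :=
  p.IsPrime ∧ ∃ a : R, p = Submodule.colon J {a}

/-- The prime ideal `p` is a minimal associated prime of `J`: it is associated to `J`, and no
associated prime of `J` is properly contained in it. -/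
def IsMinimalAssocPrime {R : Type u} [CommRing R] (p J : Ideal R) : Prop :=
  IsAssocPrime p J ∧ ∀ q : Ideal R, IsAssocPrime q J → ¬ q < p

/-- The fr-dimension of a local ring: the supremum of the lengths of the chains of finitely
related prime ideals, that is, of associated primes of finitely generated ideals. -/
def frDim (R : Type u) [CommRing R] : WithBot ℕ∞ :=
  Order.krullDim {p : PrimeSpectrum R // ∃ J : Ideal R, J.FG ∧ IsAssocPrime p.asIdeal J}

/-- The pi-dimension of a local ring: the least `d` such that the maximal ideal is a minimal
associated prime of an ideal generated by `d` elements (`⊤` if there is none). -/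
def piDim (R : Type u) [CommRing R] [IsLocalRing R] : ℕ∞ :=
  ⨅ (d : ℕ) (_ : ∃ x : Fin d → R,
    IsMinimalAssocPrime (IsLocalRing.maximalIdeal R) (Ideal.span (Set.range x))), (d : ℕ∞)

/-! ### Depth -/

section Koszul

variable {R : Type u} [CommRing R] {n : ℕ}

/-- The differential of the Koszul complex of `x = (x_1, …, x_n)`. The free module with basis
the vectors `e_S = e_{j_1} ∧ ⋯ ∧ e_{j_i}`, for `S = {j_1 < ⋯ < j_i}`, is realized as the
functions `c` of `S`, and the differential sends `e_S` to the sum over `k` of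
`(-1) ^ (k - 1) * x_{j_k}` times `e_{S \ {j_k}}`. -/
def koszulD (x : Fin n → R) : (Finset (Fin n) → R) →ₗ[R] (Finset (Fin n) → R) where
  toFun c T := ∑ j ∈ Tᶜ, (-1) ^ (T.filter (· < j)).card * x j * c (insert j T)
  map_add' c c' := by
    funext T
    simp [mul_add, Finset.sum_add_distrib]
  map_smul' r c := by
    funext T
    simp only [Pi.smul_apply, smul_eq_mul, RingHom.id_apply, Finset.mul_sum]
    exact Finset.sum_congr rfl fun j _ => by ring

variable (R n) in
/-- The degree `i` part of the Koszul complex: the functions supported on the sets with `i`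
elements. -/
def koszulDeg (i : ℕ) : Submodule R (Finset (Fin n) → R) where
  carrier := {c | ∀ S : Finset (Fin n), S.card ≠ i → c S = 0}
  add_mem' := by
    intro c c' h h' S hS
    simp [h S hS, h' S hS]
  zero_mem' := fun _ _ => rfl
  smul_mem' := by
    intro r c h S hS
    simp [h S hS]

/-- The `i`-th Koszul homology `H_i(x; R)` vanishes: every cycle of degree `i` is the boundary
of a chain of degree `i + 1`. -/
def KoszulVanishes (x : Fin n → R) (i : ℕ) : Prop :=
  ∀ c ∈ koszulDeg R n i, koszulD x c = 0 → ∃ b ∈ koszulDeg R n (i + 1), koszulD x b = c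

/-- The grade of a tuple `x` of length `n` generating a proper ideal: `n - h`, where `h` is the
largest `i` such that `H_i(x; R)` is non-zero. (One has `0 ≤ h ≤ n`, as `H_0(x; R)` is the
residue ring modulo the ideal generated by `x`, and there are no chains of degree above `n`.) -/
def koszulGrade (x : Fin n → R) : ℕ :=
  n - sSup {i : ℕ | ¬ KoszulVanishes x i}

end Koszul

/-- The depth of a local ring of finite embedding dimension: the grade of its maximal ideal. The
grade of a tuple generating the maximal ideal does not depend on the tuple; this common value is
written as the supremum over all generating tuples. -/
def depth (R : Type u) [CommRing R] [IsLocalRing R] : ℕ∞ :=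
  ⨆ (n : ℕ) (x : Fin n → R) (_ : Ideal.span (Set.range x) = IsLocalRing.maximalIdeal R),
    (koszulGrade x : ℕ∞)

end UltraNoeth

end

/-!
Write `S` for the ultraproduct and `𝔪` for its maximal ideal, which is finitely generated
because the embedding dimensions are bounded. Two mechanisms carry the proof.

*Transfer.* Ideals with generators, their colon ideals, primality, inclusion and the vanishing
of Koszul homology are governed by finitely many equations, so they pass between `S` and almost
all `R_w` (`IsUltraIdeal`, `IsUltraIdealFG`, `IsUltraproductMap.eventually_koszulVanishes`).
This turns statements on `S` into statements on Noetherian local rings `R_w` of the same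
dimension `h`, provided the numbers of generators are bounded. A prime of height at most `h` is
minimal over an ideal with `h` generators, hence associated to it, which gives `frDim S = h`;
the ideals of which the maximal ideal of `R_w` is a minimal associated prime are the primary
ones, which need at least `h` generators and can have exactly `h`, so `piDim S = h`. Depth is at
most `h` because, in a Noetherian local ring, vanishing of the Koszul homology in the top `g`
degrees allows one to divide out a nonzerodivisor, lowering both `g` and the dimension by one
(`le_ringKrullDim_of_koszulVanishes`).

*Approximation.* For a local ring `R` with finitely generated maximal ideal, `PseudoDimLE d R`
says that some `d` elements generate an ideal containing a power of `𝔪` (`pseudoDimLE_iff`). By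
Nakayama's lemma this condition is insensitive to passing to any Noetherian local ring with the
same quotients by the powers of the maximal ideal, where it says that the dimension is at most
`d` (`pseudoDimLE_iff_ringKrullDim_le`). It is applied to two such rings. One is the completion,
whose Noetherianity rests on the initial forms of an ideal being finitely generated
(`exists_fg_le_inf_pow_le`). The other is the separated quotient `S / ⋂ 𝔪 ^ n`: by Krull's
intersection theorem in the `R_w`, finitely generated ideals of `S` are closed up to `⋂ 𝔪 ^ n`
(`IsUltraIdealFG.iInf_sup_pow_le`), so that this quotient is Noetherian and its primes
correspond to the closed primes of `S`. Hence `clDim S`, `pseudoDim S` and `cataDim S` coincide.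
Finally a relation `𝔪 ^ N ≤ (x_1, …, x_d)` transfers to almost all `R_w`, so `h ≤ pseudoDim S`.
-/

noncomputable section

namespace UltraNoeth

open IsLocalRing

/-! ### Systems of parameters and pseudo-dimension -/

/-- A finite generating family can be padded by zeros to any larger length. -/
theorem exists_span_range_fin_eq {R : Type*} [CommRing R] {n d : ℕ} (hnd : n ≤ d) (x : Fin n → R) :
    ∃ y : Fin d → R, Ideal.span (Set.range y) = Ideal.span (Set.range x) := by
  refine ⟨fun i => if h : (i : ℕ) < n then x ⟨i, h⟩ else 0, le_antisymm ?_ ?_⟩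
  · rw [Ideal.span_le]
    rintro _ ⟨i, rfl⟩
    dsimp only
    split_ifs with h
    · exact Ideal.subset_span ⟨_, rfl⟩
    · exact Ideal.zero_mem _
  · rw [Ideal.span_le]
    rintro _ ⟨i, rfl⟩
    refine Ideal.subset_span ⟨⟨i, i.2.trans_le hnd⟩, ?_⟩
    simp

theorem exists_span_range_fin_eq_finset {R : Type*} [CommRing R] {d : ℕ} (s : Finset R)
    (hs : s.card ≤ d) : ∃ y : Fin d → R, Ideal.span (Set.range y) = Ideal.span (s : Set R) := by
  obtain ⟨y, hy⟩ := exists_span_range_fin_eq hs (fun i => (s.equivFin.symm i : R))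
  refine ⟨y, hy.trans ?_⟩
  congr 1
  rw [show (fun i => (s.equivFin.symm i : R)) = Subtype.val ∘ s.equivFin.symm from rfl,
    Set.range_comp, s.equivFin.symm.range_eq_univ]
  simp

theorem maximalIdeal_mem_minimalPrimes {R : Type*} [CommRing R] [IsLocalRing R] {I : Ideal R}
    (hI : I ≤ maximalIdeal R) {N : ℕ} (hN : maximalIdeal R ^ N ≤ I) :
    maximalIdeal R ∈ I.minimalPrimes := by
  refine ⟨⟨inferInstance, hI⟩, fun q hq _ => ?_⟩
  have := hq.1
  exact Ideal.IsPrime.le_of_pow_le (hN.trans hq.2)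

/-- In a Noetherian local ring, an ideal of which the maximal ideal is a minimal prime contains a
power of the maximal ideal. -/
theorem exists_maximalIdeal_pow_le {R : Type*} [CommRing R] [IsLocalRing R] [IsNoetherianRing R]
    {I : Ideal R} (hI : maximalIdeal R ∈ I.minimalPrimes) : ∃ N, maximalIdeal R ^ N ≤ I := by
  have hrad : I.radical = maximalIdeal R := by
    rw [Ideal.radical_eq_sInf]
    refine le_antisymm (sInf_le ⟨hI.1.2, hI.1.1⟩) (le_sInf fun q hq => ?_)
    have := hq.2
    exact hI.2 ⟨hq.2, hq.1⟩ (le_maximalIdeal hq.2.ne_top)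
  rw [← hrad]
  exact Ideal.exists_radical_pow_le_of_fg I (IsNoetherian.noetherian _)

/-- The Krull dimension of a Noetherian local ring is the least length of a tuple generating an
ideal that contains a power of the maximal ideal. -/
theorem ringKrullDim_le_iff {R : Type*} [CommRing R] [IsLocalRing R] [IsNoetherianRing R] (d : ℕ) :
    ringKrullDim R ≤ ((d : ℕ∞) : WithBot ℕ∞) ↔ ∃ x : Fin d → R, (∀ i, x i ∈ maximalIdeal R) ∧
      ∃ N, maximalIdeal R ^ N ≤ Ideal.span (Set.range x) := by
  rw [← IsLocalRing.maximalIdeal_height_eq_ringKrullDim, WithBot.coe_le_coe]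
  constructor
  · intro h
    obtain ⟨s, hs, hcard⟩ := Ideal.exists_finset_card_eq_height_of_isNoetherianRing (maximalIdeal R)
    rw [← hcard, Nat.cast_le] at h
    obtain ⟨x, hx⟩ := exists_span_range_fin_eq_finset s h
    rw [← hx] at hs
    refine ⟨x, fun i => hs.1.2 (Ideal.subset_span ⟨i, rfl⟩), exists_maximalIdeal_pow_le hs⟩
  · rintro ⟨x, hx, N, hN⟩
    have hle : Ideal.span (Set.range x) ≤ maximalIdeal R := by
      rw [Ideal.span_le]
      rintro _ ⟨i, rfl⟩
      exact hx i
    have h1 := Ideal.height_le_card_of_mem_minimalPrimes_span (Set.finite_range x)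
      (maximalIdeal_mem_minimalPrimes hle hN)
    refine h1.trans ?_
    rw [← Set.image_univ, Nat.cast_le]
    refine (Set.ncard_image_le (Set.toFinite _)).trans ?_
    simp

/-- A local ring with finitely generated maximal ideal is Artinian if and only if its maximal ideal
is nilpotent. -/
theorem isArtinianRing_iff_maximalIdeal_pow {R : Type*} [CommRing R] [IsLocalRing R]
    (hfg : (maximalIdeal R).FG) : IsArtinianRing R ↔ ∃ N, maximalIdeal R ^ N = ⊥ := by
  constructor
  · intro h
    rw [← IsLocalRing.jacobson_eq_maximalIdeal ⊥ bot_ne_top]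
    exact IsArtinianRing.isNilpotent_jacobson_bot
  · rintro ⟨N, hN⟩
    have hprime : ∀ q : Ideal R, q.IsPrime → q = maximalIdeal R := fun q hq =>
      le_antisymm (le_maximalIdeal hq.ne_top) (Ideal.IsPrime.le_of_pow_le (hN.trans_le bot_le))
    have : IsNoetherianRing R := IsNoetherianRing.of_prime fun q hq => hprime q hq ▸ hfg
    exact (isArtinianRing_iff_isNilpotent_maximalIdeal R).mpr ⟨N, hN⟩

theorem map_mk_maximalIdeal {R : Type*} [CommRing R] [IsLocalRing R] (I : Ideal R)
    [IsLocalRing (R ⧸ I)] :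
    (maximalIdeal R).map (Ideal.Quotient.mk I) = maximalIdeal (R ⧸ I) := by
  have hsurj := Ideal.Quotient.mk_surjective (I := I)
  have : IsLocalHom (Ideal.Quotient.mk I) := IsLocalHom.of_surjective _ hsurj
  refine le_antisymm ?_ fun a ha => ?_
  · rw [Ideal.map_le_iff_le_comap, IsLocalRing.maximalIdeal_comap]
  · obtain ⟨b, rfl⟩ := hsurj a
    refine Ideal.mem_map_of_mem _ ?_
    rwa [← IsLocalRing.maximalIdeal_comap (Ideal.Quotient.mk I)]

theorem isLocalRing_quotient {R : Type*} [CommRing R] [IsLocalRing R] {I : Ideal R}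
    (hI : I ≤ maximalIdeal R) : IsLocalRing (R ⧸ I) := by
  have : Nontrivial (R ⧸ I) :=
    Ideal.Quotient.nontrivial_iff.mpr fun h =>
      (maximalIdeal.isMaximal R).ne_top (top_le_iff.mp (h ▸ hI))
  exact IsLocalRing.of_surjective' _ Ideal.Quotient.mk_surjective

/-- The pseudo-dimension of a local ring with finitely generated maximal ideal is the least length
of a tuple generating an ideal that contains a power of the maximal ideal. -/
theorem pseudoDimLE_iff (d : ℕ) : ∀ (R : Type*) [CommRing R] [IsLocalRing R],
    (maximalIdeal R).FG → (PseudoDimLE d R ↔ ∃ x : Fin d → R, (∀ i, x i ∈ maximalIdeal R) ∧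
      ∃ N, maximalIdeal R ^ N ≤ Ideal.span (Set.range x)) := by
  induction d with
  | zero =>
    intro R _ _ hfg
    rw [PseudoDimLE, isArtinianRing_iff_maximalIdeal_pow hfg]
    constructor
    · rintro ⟨N, hN⟩
      exact ⟨Fin.elim0, fun i => i.elim0, N, hN.trans_le bot_le⟩
    · rintro ⟨x, -, N, hN⟩
      refine ⟨N, ?_⟩
      rwa [Set.range_eq_empty, Ideal.span_empty, le_bot_iff] at hN
  | succ d ih =>
    intro R _ _ hfg
    -- Everything takes place in the quotient by the first element of the tuple.
    have key : ∀ (x : R) (y : Fin d → R), x ∈ maximalIdeal R →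
        (((∀ i, Ideal.Quotient.mk (Ideal.span {x}) (y i) ∈
            (maximalIdeal R).map (Ideal.Quotient.mk (Ideal.span {x}))) ∧
          ∃ N, (maximalIdeal R).map (Ideal.Quotient.mk (Ideal.span {x})) ^ N ≤
            Ideal.span (Set.range fun i => Ideal.Quotient.mk (Ideal.span {x}) (y i))) ↔
        ((∀ i, y i ∈ maximalIdeal R) ∧
          ∃ N, maximalIdeal R ^ N ≤ Ideal.span (Set.range (Fin.cons x y : Fin (d + 1) → R)))) := by
      intro x y hx
      have hxle : Ideal.span {x} ≤ maximalIdeal R := by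
        rwa [Ideal.span_singleton_le_iff_mem]
      refine and_congr (forall_congr' fun i => ?_) (exists_congr fun N => ?_)
      · rw [← Ideal.mem_comap, Ideal.comap_map_of_surjective _ Ideal.Quotient.mk_surjective,
          ← RingHom.ker_eq_comap_bot, Ideal.mk_ker, sup_eq_left.mpr hxle]
      · rw [← Ideal.map_pow, Ideal.map_le_iff_le_comap]
        rw [show (Set.range fun i => Ideal.Quotient.mk (Ideal.span {x}) (y i)) =
          Ideal.Quotient.mk (Ideal.span {x}) '' Set.range y by rw [← Set.range_comp]; rfl,
          ← Ideal.map_span, Ideal.comap_map_of_surjective _ Ideal.Quotient.mk_surjective,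
          ← RingHom.ker_eq_comap_bot, Ideal.mk_ker, Fin.range_cons, Ideal.span_insert, sup_comm]
    constructor
    · rintro ⟨x, hx, hR⟩
      have hxm : x ∈ maximalIdeal R := hx
      have : IsLocalRing (R ⧸ Ideal.span {x}) :=
        isLocalRing_quotient (by rwa [Ideal.span_singleton_le_iff_mem])
      rw [ih _ (by rw [← map_mk_maximalIdeal]; exact hfg.map _), ← map_mk_maximalIdeal] at hR
      obtain ⟨y, hy⟩ := hR
      obtain ⟨z, rfl⟩ : ∃ z : Fin d → R, (fun i => Ideal.Quotient.mk (Ideal.span {x}) (z i)) = y :=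
        ⟨fun i => (Ideal.Quotient.mk_surjective (y i)).choose,
          funext fun i => (Ideal.Quotient.mk_surjective (y i)).choose_spec⟩
      have h := (key x z hxm).mp hy
      exact ⟨Fin.cons x z, Fin.cases hxm h.1, h.2⟩
    · rintro ⟨z, hz, hN⟩
      refine ⟨z 0, hz 0, ?_⟩
      have : IsLocalRing (R ⧸ Ideal.span {z 0}) :=
        isLocalRing_quotient (by rw [Ideal.span_singleton_le_iff_mem]; exact hz 0)
      rw [ih _ (by rw [← map_mk_maximalIdeal]; exact hfg.map _), ← map_mk_maximalIdeal]
      refine ⟨_, (key (z 0) (Fin.tail z) (hz 0)).mpr ⟨fun i => hz _, ?_⟩⟩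
      rwa [Fin.cons_self_tail]

/-- Pseudo-dimension and Krull dimension are compared along a ring homomorphism `φ : R → B` with
`B` Noetherian that identifies `R / 𝔪 ^ n` with `B / 𝔪_B ^ n` for all `n`. -/
theorem pseudoDimLE_iff_ringKrullDim_le {R B : Type*} [CommRing R] [IsLocalRing R] [CommRing B]
    [IsLocalRing B] [IsNoetherianRing B] (hfg : (maximalIdeal R).FG) (φ : R →+* B)
    (hmap : (maximalIdeal R).map φ = maximalIdeal B)
    (hdense : ∀ (n : ℕ) (b : B), ∃ a, b - φ a ∈ maximalIdeal B ^ n)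
    (hcomap : ∀ n a, φ a ∈ maximalIdeal B ^ n → a ∈ maximalIdeal R ^ n) (d : ℕ) :
    PseudoDimLE d R ↔ ringKrullDim B ≤ ((d : ℕ∞) : WithBot ℕ∞) := by
  have hrange : ∀ x : Fin d → R, (Ideal.span (Set.range x)).map φ =
      Ideal.span (Set.range fun i => φ (x i)) := fun x => by
    rw [Ideal.map_span, ← Set.range_comp]; rfl
  rw [pseudoDimLE_iff d R hfg, ringKrullDim_le_iff]
  constructor
  · rintro ⟨x, hx, N, hN⟩
    refine ⟨fun i => φ (x i), fun i => hmap ▸ Ideal.mem_map_of_mem φ (hx i), N, ?_⟩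
    rw [← hmap, ← Ideal.map_pow, ← hrange]
    exact Ideal.map_mono hN
  · rintro ⟨y, hy, N, hN⟩
    -- Approximate the tuple modulo a higher power than the one it is known to generate, and use
    -- Nakayama's lemma.
    choose x hx using fun i => hdense (N + 1 + 1) (y i)
    have hxm : ∀ i, φ (x i) ∈ maximalIdeal B := fun i => by
      have := Ideal.pow_le_self (Nat.succ_ne_zero _) (hx i)
      have h2 := Ideal.sub_mem _ (hy i) this
      rwa [sub_sub_cancel] at h2
    refine ⟨x, fun i => ?_, N, ?_⟩
    · have := hcomap 1 (x i) (by rw [pow_one]; exact hxm i)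
      rwa [pow_one] at this
    have hspan : Ideal.span (Set.range y) ≤
        (Ideal.span (Set.range x)).map φ ⊔ maximalIdeal B ^ (N + 1) := by
      rw [Ideal.span_le]
      rintro _ ⟨i, rfl⟩
      rw [← add_sub_cancel (φ (x i)) (y i)]
      refine Ideal.add_mem _
        (Ideal.mem_sup_left (Ideal.mem_map_of_mem φ (Ideal.subset_span ⟨i, rfl⟩)))
        (Ideal.mem_sup_right (Ideal.pow_le_pow_right (Nat.le_succ _) (hx i)))
    have happrox : ∀ b ∈ (Ideal.span (Set.range x)).map φ,
        ∃ a ∈ Ideal.span (Set.range x), b - φ a ∈ maximalIdeal B ^ (N + 1) := by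
      intro b hb
      rw [hrange] at hb
      obtain ⟨c, rfl⟩ := (Ideal.mem_span_range_iff_exists_fun).mp hb
      choose a ha using fun i => hdense (N + 1) (c i)
      refine ⟨∑ i, a i * x i, Ideal.mem_span_range_iff_exists_fun.mpr ⟨a, rfl⟩, ?_⟩
      rw [map_sum, ← Finset.sum_sub_distrib]
      refine Ideal.sum_mem _ fun i _ => ?_
      rw [map_mul, ← sub_mul]
      exact Ideal.mul_mem_right _ _ (ha i)
    have hle : maximalIdeal R ^ N ≤
        Ideal.span (Set.range x) ⊔ maximalIdeal R • maximalIdeal R ^ N := by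
      intro a ha
      have h1 : φ a ∈ maximalIdeal B ^ N := by
        rw [← hmap, ← Ideal.map_pow]
        exact Ideal.mem_map_of_mem _ ha
      obtain ⟨b, hb, c, hc, hbc⟩ := Submodule.mem_sup.mp (hspan (hN h1))
      obtain ⟨r, hr, hrb⟩ := happrox b hb
      have h2 : φ (a - r) ∈ maximalIdeal B ^ (N + 1) := by
        rw [map_sub, ← hbc, add_sub_right_comm]
        exact Ideal.add_mem _ hrb hc
      have h3 := hcomap _ _ h2
      rw [← add_sub_cancel r a]
      refine Ideal.add_mem _ (Ideal.mem_sup_left hr) (Ideal.mem_sup_right ?_)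
      rwa [smul_eq_mul, ← pow_succ']
    exact Submodule.le_of_le_smul_of_le_jacobson_bot (hfg.pow)
      (IsLocalRing.maximalIdeal_le_jacobson _) hle

theorem pseudoDim_eq_ringKrullDim {R B : Type*} [CommRing R] [IsLocalRing R] [CommRing B]
    [IsLocalRing B] [IsNoetherianRing B]
    (h : ∀ d, PseudoDimLE d R ↔ ringKrullDim B ≤ ((d : ℕ∞) : WithBot ℕ∞)) :
    (pseudoDim R : WithBot ℕ∞) = ringKrullDim B := by
  rw [← IsLocalRing.maximalIdeal_height_eq_ringKrullDim] at h ⊢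
  simp_rw [WithBot.coe_le_coe] at h
  rw [WithBot.coe_inj, pseudoDim]
  refine le_antisymm ?_ (le_iInf₂ fun d hd => (h d).mp hd)
  obtain ⟨n, hn⟩ := ENat.ne_top_iff_exists.mp
    (Ideal.height_ne_top (maximalIdeal.isMaximal B).ne_top)
  rw [← hn]
  exact iInf₂_le n ((h n).mpr hn.ge)

theorem pseudoDim_le_embDim {R : Type*} [CommRing R] [IsLocalRing R]
    (hfg : (maximalIdeal R).FG) : pseudoDim R ≤ embDim R := by
  refine le_iInf₂ fun n hn => ?_
  obtain ⟨x, hx⟩ := hn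
  refine iInf₂_le n ((pseudoDimLE_iff n R hfg).mpr
    ⟨x, fun i => hx ▸ Ideal.subset_span ⟨i, rfl⟩, 1, ?_⟩)
  rw [pow_one, hx]

/-! ### Initial forms, complete rings and cata-dimension -/

open MvPolynomial in
theorem homogeneousComponent_mul_of_isHomogeneous {σ R : Type*} [CommRing R] (G : MvPolynomial σ R)
    {F : MvPolynomial σ R} {d : ℕ} (hF : F.IsHomogeneous d) (e : ℕ) :
    homogeneousComponent e (G * F) =
      (if d ≤ e then homogeneousComponent (e - d) G else 0) * F := by
  have h1 : ∀ i, homogeneousComponent e (homogeneousComponent i G * F) =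
      if i + d = e then homogeneousComponent i G * F else 0 := fun i => by
    rw [homogeneousComponent_of_mem ((homogeneousComponent_isHomogeneous i G).mul hF)]
    simp only [eq_comm]
  conv_lhs => rw [← sum_homogeneousComponent G]
  rw [Finset.sum_mul, map_sum, Finset.sum_congr rfl fun i _ => h1 i]
  split_ifs with hd
  · have h2 : ∀ i, (i + d = e) = (i = e - d) := fun i => propext (by omega)
    simp_rw [h2]
    rw [Finset.sum_ite_eq']
    split_ifs with hmem
    · rfl
    · rw [homogeneousComponent_eq_zero, zero_mul]
      simp only [Finset.mem_range] at hmem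
      omega
  · rw [zero_mul]
    refine Finset.sum_eq_zero fun i _ => if_neg (by omega)

/-- A form of degree `e` with coefficients in the ideal generated by `x` takes at `x` a value in
the power `e + 1` of that ideal. -/
theorem eval_mem_span_pow_succ {ι R : Type*} [CommRing R] (x : ι → R) {e : ℕ}
    {D : MvPolynomial ι R} (hD : D.IsHomogeneous e)
    (hcoeff : MvPolynomial.map (Ideal.Quotient.mk (Ideal.span (Set.range x))) D = 0) :
    MvPolynomial.eval x D ∈ Ideal.span (Set.range x) ^ (e + 1) := by
  rw [D.as_sum, map_sum]
  refine Ideal.sum_mem _ fun m hm => ?_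
  rw [← mul_one (MvPolynomial.coeff m D), ← MvPolynomial.C_mul_monomial, map_mul,
    MvPolynomial.eval_C, pow_succ']
  refine Ideal.mul_mem_mul ?_ ?_
  · rw [← Ideal.Quotient.eq_zero_iff_mem, ← MvPolynomial.coeff_map, hcoeff, MvPolynomial.coeff_zero]
  · refine (Ideal.mem_span_pow_iff_exists_isHomogeneous x _).mpr ⟨_, ?_, rfl⟩
    have hdeg := hD (MvPolynomial.mem_support_iff.mp hm)
    rw [Pi.one_def, ← Finsupp.degree_eq_weight_one] at hdeg
    exact MvPolynomial.isHomogeneous_monomial _ hdeg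

/-- An Artin-Rees property: for a finitely generated ideal `I` with Noetherian residue ring, every
ideal `P` contains a finitely generated ideal `J` whose initial forms generate those of `P`. No
Noetherian hypothesis on `R` is needed, as the initial forms lie in a polynomial ring
over `R / I`. -/
theorem exists_fg_le_inf_pow_le {R : Type*} [CommRing R] (I : Ideal R) (hI : I.FG)
    [IsNoetherianRing (R ⧸ I)] (P : Ideal R) :
    ∃ J ≤ P, J.FG ∧ ∃ c, ∀ e, P ⊓ I ^ e ≤ I ^ (e - c) * J ⊔ I ^ (e + 1) := by
  obtain ⟨n, x, rfl⟩ := Submodule.fg_iff_exists_fin_generating_family.mp hI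
  change ∃ J ≤ P, J.FG ∧ ∃ c, ∀ e, P ⊓ Ideal.span (Set.range x) ^ e ≤
    Ideal.span (Set.range x) ^ (e - c) * J ⊔ Ideal.span (Set.range x) ^ (e + 1)
  set I := Ideal.span (Set.range x) with hIdef
  have : IsNoetherianRing (R ⧸ I) := ‹_›
  let φ : MvPolynomial (Fin n) R →+* MvPolynomial (Fin n) (R ⧸ I) :=
    MvPolynomial.map (Ideal.Quotient.mk I)
  have hφ : Function.Surjective φ := MvPolynomial.map_surjective _ Ideal.Quotient.mk_surjective
  let T : Set (MvPolynomial (Fin n) (R ⧸ I)) :=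
    {G | ∃ d F, F.IsHomogeneous d ∧ MvPolynomial.eval x F ∈ P ⊔ I ^ (d + 1) ∧ φ F = G}
  obtain ⟨s, hsT, hs⟩ := (Submodule.fg_span_iff_fg_span_finset_subset T).mp
    (IsNoetherian.noetherian (Ideal.span T))
  choose d F hF hFP hFφ using fun G : s => hsT G.2
  choose f hf r hr hfr using fun G : s => Submodule.mem_sup.mp (hFP G)
  refine ⟨Ideal.span (Set.range f), ?_, ?_, Finset.univ.sup d, ?_⟩
  · rw [Ideal.span_le]
    rintro _ ⟨G, rfl⟩
    exact hf G
  · exact Submodule.fg_span (Set.finite_range f)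
  rintro e a ⟨haP, haI⟩
  obtain ⟨A, hA, rfl⟩ := (Ideal.mem_span_pow_iff_exists_isHomogeneous x a).mp haI
  have hAT : φ A ∈ Ideal.span (s : Set (MvPolynomial (Fin n) (R ⧸ I))) := by
    change φ A ∈ Submodule.span _ _
    rw [← hs]
    exact Submodule.subset_span ⟨e, A, hA, Ideal.mem_sup_left haP, rfl⟩
  obtain ⟨g, hg⟩ := Submodule.mem_span_finset'.mp hAT
  choose C hC using fun G : s => hφ (g G)
  let K : s → MvPolynomial (Fin n) R := fun G =>
    if d G ≤ e then MvPolynomial.homogeneousComponent (e - d G) (C G) else 0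
  -- the degree `e` part of the relation expressing the form `A` by the chosen generators
  have hD : A - ∑ G, K G * F G = MvPolynomial.homogeneousComponent e (A - ∑ G, C G * F G) := by
    rw [map_sub, map_sum, MvPolynomial.homogeneousComponent_eq_self hA]
    congr 1
    exact Finset.sum_congr rfl fun G _ =>
      (homogeneousComponent_mul_of_isHomogeneous (C G) (hF G) e).symm
  have hD0 : φ (A - ∑ G, C G * F G) = 0 := by
    rw [map_sub, map_sum, sub_eq_zero, ← hg]
    refine Finset.sum_congr rfl fun G _ => ?_
    rw [map_mul, hC, hFφ, smul_eq_mul]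
  have hmem : MvPolynomial.eval x (A - ∑ G, K G * F G) ∈ I ^ (e + 1) := by
    refine eval_mem_span_pow_succ x ?_ ?_
    · rw [hD]; exact MvPolynomial.homogeneousComponent_isHomogeneous _ _
    · rw [hD]
      ext m
      rw [MvPolynomial.coeff_map, MvPolynomial.coeff_homogeneousComponent]
      split_ifs
      · have := congrArg (MvPolynomial.coeff m) hD0
        rwa [MvPolynomial.coeff_map] at this
      · simp
  have hsum : MvPolynomial.eval x (∑ G, K G * F G) ∈
      I ^ (e - Finset.univ.sup d) * Ideal.span (Set.range f) ⊔ I ^ (e + 1) := by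
    rw [map_sum]
    refine Ideal.sum_mem _ fun G _ => ?_
    rw [map_mul]
    by_cases hde : d G ≤ e
    · have hK : MvPolynomial.eval x (K G) ∈ I ^ (e - d G) :=
        (Ideal.mem_span_pow_iff_exists_isHomogeneous x _).mpr ⟨K G, by
          simp only [K, if_pos hde]
          exact MvPolynomial.homogeneousComponent_isHomogeneous _ _, rfl⟩
      rw [← hfr, mul_add]
      refine Ideal.add_mem _ (Ideal.mem_sup_left ?_) (Ideal.mem_sup_right ?_)
      · refine Ideal.mul_mem_mul (Ideal.pow_le_pow_right ?_ hK) (Ideal.subset_span ⟨G, rfl⟩)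
        have := Finset.le_sup (f := d) (Finset.mem_univ G)
        omega
      · have := Ideal.mul_mem_mul hK (hr G)
        rw [← pow_add] at this
        exact Ideal.pow_le_pow_right (by omega) this
    · simp only [K, if_neg hde, map_zero, zero_mul]
      exact Ideal.zero_mem _
  have := Ideal.add_mem _ (Ideal.mem_sup_right hmem :
    _ ∈ I ^ (e - Finset.univ.sup d) * Ideal.span (Set.range f) ⊔ I ^ (e + 1)) hsum
  rwa [← map_add, sub_add_cancel] at this

/-- Every ideal has a finitely generated ideal inside it that is dense for the `I`-adic
topology. -/
theorem exists_fg_le_sup_pow {R : Type*} [CommRing R] (I : Ideal R) (hI : I.FG)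
    [IsNoetherianRing (R ⧸ I)] (P : Ideal R) :
    ∃ J ≤ P, J.FG ∧ ∀ n, P ≤ J ⊔ I ^ n := by
  obtain ⟨J, hJP, hJ, c, hc⟩ := exists_fg_le_inf_pow_le I hI P
  refine ⟨J, hJP, hJ, fun n => ?_⟩
  induction n with
  | zero => simp
  | succ n ih =>
    intro a ha
    obtain ⟨j, hj, b, hb, rfl⟩ := Submodule.mem_sup.mp (ih ha)
    have hbP : b ∈ P := by
      have := P.sub_mem ha (hJP hj)
      rwa [add_sub_cancel_left] at this
    exact Ideal.add_mem _ (Ideal.mem_sup_left hj)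
      ((sup_le_sup_right Ideal.mul_le_right _ : _ ≤ J ⊔ I ^ (n + 1)) (hc n ⟨hbP, hb⟩))

/-- A ring that is complete with respect to a finitely generated ideal with Noetherian residue
ring is Noetherian. -/
theorem isNoetherianRing_of_isAdicComplete {R : Type*} [CommRing R] (I : Ideal R) (hI : I.FG)
    [IsNoetherianRing (R ⧸ I)] [IsAdicComplete I R] : IsNoetherianRing R := by
  refine (isNoetherianRing_iff_ideal_fg R).mpr fun P => ?_
  obtain ⟨J, hJP, hJ, c, hc⟩ := exists_fg_le_inf_pow_le I hI P
  obtain ⟨k, f, rfl⟩ := Submodule.fg_iff_exists_fin_generating_family.mp hJ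
  suffices h : P ≤ Ideal.span (Set.range f) by
    rw [le_antisymm h hJP]
    exact hJ
  intro a ha
  -- Successively improved remainders `u n ∈ P ⊓ I ^ n`, with the coefficients used in each step.
  have step : ∀ n (b : (P ⊓ I ^ n : Ideal R)), ∃ (b' : (P ⊓ I ^ (n + 1) : Ideal R)) (t : Fin k → R),
      (∀ i, t i ∈ I ^ (n - c)) ∧ (b : R) = ∑ i, t i * f i + b' := by
    rintro n ⟨b, hb⟩
    obtain ⟨y, hy, z, hz, rfl⟩ := Submodule.mem_sup.mp (hc n hb)
    have hy' : y ∈ I ^ (n - c) • Submodule.span R (Set.range f) := hy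
    obtain ⟨t, ht, hty⟩ := (Submodule.mem_ideal_smul_span_iff_exists_sum _ _ _).mp hy'
    have hyP : y ∈ P := hJP (Ideal.mul_le_right hy)
    refine ⟨⟨z, ?_, hz⟩, t, ht, ?_⟩
    · have := P.sub_mem hb.1 hyP
      rwa [add_sub_cancel_left] at this
    · rw [Finsupp.sum_fintype _ _ (by simp)] at hty
      change y + z = ∑ i, t i • f i + z
      rw [hty]
  choose u' t ht hut using step
  let u : ∀ n : ℕ, (P ⊓ I ^ n : Ideal R) := fun n =>
    Nat.rec ⟨a, ha, by simp⟩ (fun n b => u' n b) n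
  let s : Fin k → ℕ → R := fun i n => ∑ j ∈ Finset.range n, t j (u j) i
  have hu : ∀ n : ℕ, a = ∑ i, s i n * f i + (u n).1 := by
    intro n
    induction n with
    | zero => simp [s, u]
    | succ n ih =>
      rw [ih, hut n (u n)]
      simp only [s, Finset.sum_range_succ, add_mul, Finset.sum_add_distrib]
      rw [add_assoc]
  -- The shift by `c` absorbs the loss in the exponents of the coefficients.
  have hcauchy : ∀ i, ∃ L, ∀ n, s i (n + c) - L ∈ I ^ n := by
    intro i
    obtain ⟨L, hL⟩ := IsPrecomplete.prec' (I := I) (fun n => s i (n + c)) (by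
      intro m n hmn
      rw [SModEq.comm, SModEq.sub_mem, smul_eq_mul, Ideal.mul_top]
      simp only [s]
      rw [← Finset.sum_range_add_sum_Ico _ (Nat.add_le_add_right hmn c), add_sub_cancel_left]
      refine Ideal.sum_mem _ fun j hj => Ideal.pow_le_pow_right ?_ (ht j (u j) i)
      rw [Finset.mem_Ico] at hj
      omega)
    refine ⟨L, fun n => ?_⟩
    have := hL n
    rwa [SModEq.sub_mem, smul_eq_mul, Ideal.mul_top] at this
  choose L hL using hcauchy
  have hlim : a - ∑ i, L i * f i = 0 := by
    refine IsHausdorff.haus (I := I) inferInstance _ fun n => ?_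
    rw [SModEq.zero, smul_eq_mul, Ideal.mul_top]
    rw [hu (n + c), add_sub_right_comm, ← Finset.sum_sub_distrib]
    refine Ideal.add_mem _ (Ideal.sum_mem _ fun i _ => ?_)
      (Ideal.pow_le_pow_right (Nat.le_add_right _ _) (u (n + c)).2.2)
    rw [← sub_mul]
    exact Ideal.mul_mem_right _ _ (hL i n)
  rw [sub_eq_zero.mp hlim]
  exact Ideal.mem_span_range_iff_exists_fun.mpr ⟨L, rfl⟩

theorem isNoetherianRing_adicCompletion {R : Type*} [CommRing R] [IsLocalRing R]
    (hfg : (maximalIdeal R).FG) : IsNoetherianRing (AdicCompletion (maximalIdeal R) R) := by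
  have := AdicCompletion.isLocalRing_of_fg hfg
  have := AdicCompletion.isAdicComplete_of_fg hfg
  have : IsNoetherianRing (AdicCompletion (maximalIdeal R) R ⧸
      maximalIdeal (AdicCompletion (maximalIdeal R) R)) :=
    inferInstanceAs (IsNoetherianRing (ResidueField _))
  refine isNoetherianRing_of_isAdicComplete (maximalIdeal (AdicCompletion (maximalIdeal R) R)) ?_
  rw [AdicCompletion.maximalIdeal_eq_map_of_fg hfg]
  exact hfg.map _

theorem pseudoDim_eq_cataDim {R : Type*} [CommRing R] [IsLocalRing R]
    (hfg : (maximalIdeal R).FG) : (pseudoDim R : WithBot ℕ∞) = cataDim R := by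
  have := AdicCompletion.isLocalRing_of_fg hfg
  have := isNoetherianRing_adicCompletion hfg
  have hmem : ∀ n b, b ∈ maximalIdeal (AdicCompletion (maximalIdeal R) R) ^ n ↔
      AdicCompletion.eval (maximalIdeal R) R n b = 0 := by
    intro n b
    rw [← LinearMap.mem_ker, ← AdicCompletion.pow_smul_top_eq_ker_eval hfg,
      AdicCompletion.maximalIdeal_eq_map_of_fg hfg, ← Ideal.map_pow,
      ← Submodule.restrictScalars_mem R, ← Ideal.smul_top_eq_map]
  refine pseudoDim_eq_ringKrullDim (pseudoDimLE_iff_ringKrullDim_le hfg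
    (algebraMap R (AdicCompletion (maximalIdeal R) R))
    (AdicCompletion.maximalIdeal_eq_map_of_fg hfg).symm ?_ ?_)
  · intro n b
    obtain ⟨a, ha⟩ := Submodule.Quotient.mk_surjective _
      (AdicCompletion.eval (maximalIdeal R) R n b)
    refine ⟨a, (hmem _ _).mpr ?_⟩
    rw [map_sub, ← ha, sub_eq_zero]
    rfl
  · intro n a ha
    have h := (hmem _ _).mp ha
    have h2 : Submodule.Quotient.mk (p := (maximalIdeal R ^ n • ⊤ : Submodule R R)) a = 0 := h
    rwa [Submodule.Quotient.mk_eq_zero, smul_eq_mul, Ideal.mul_top] at h2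

/-! ### Ideals of an ultraproduct -/

/-- A ring homomorphism from `∏ R_w` to `S` presents `S` as the ultraproduct of the `R_w`. -/
structure IsUltraproductMap {W : Type*} (U : Ultrafilter W) {R : W → Type*} [∀ w, CommRing (R w)]
    {S : Type*} [CommRing S] (π : (∀ w, R w) →+* S) : Prop where
  surjective : Function.Surjective π
  map_eq_zero_iff : ∀ f, π f = 0 ↔ ∀ᶠ w in (U : Filter W), f w = 0

/-- The ideal `P` of the ultraproduct `S` is the ultraproduct of the ideals `I w`. -/
def IsUltraIdeal {W : Type*} (U : Ultrafilter W) {R : W → Type*} [∀ w, CommRing (R w)]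
    {S : Type*} [CommRing S] (π : (∀ w, R w) →+* S) (P : Ideal S) (I : ∀ w, Ideal (R w)) : Prop :=
  ∀ f, π f ∈ P ↔ ∀ᶠ w in (U : Filter W), f w ∈ I w

section

variable {W : Type*} {U : Ultrafilter W} {R : W → Type*} [∀ w, CommRing (R w)]
    {S : Type*} [CommRing S] {π : (∀ w, R w) →+* S}

theorem span_range_mul_span_range {A ι κ : Type*} [CommRing A] (a : ι → A) (b : κ → A) :
    Ideal.span (Set.range a) * Ideal.span (Set.range b) =
      Ideal.span (Set.range fun p : ι × κ => a p.1 * b p.2) := by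
  rw [Ideal.span_mul_span']
  congr 1
  ext z
  simp [Set.mem_mul]

theorem exists_forall_of_eventually_exists {β : W → Type*} [∀ w, Nonempty (β w)]
    {p : ∀ w, β w → Prop} (h : ∀ᶠ w in (U : Filter W), ∃ b, p w b) :
    ∃ b : ∀ w, β w, ∀ᶠ w in (U : Filter W), p w (b w) := by
  classical
  refine ⟨fun w => if h : ∃ b, p w b then h.choose else Classical.arbitrary _, ?_⟩
  filter_upwards [h] with w hw
  rw [dif_pos hw]
  exact hw.choose_spec

theorem exists_isUltraproductMap (U : Ultrafilter W) (R : W → Type*) [∀ w, CommRing (R w)]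
    (e : S ≃+* Ultraproduct U R) : ∃ π : (∀ w, R w) →+* S, IsUltraproductMap U π := by
  refine ⟨e.symm.toRingHom.comp (Ideal.Quotient.mk (almostZero U R)),
    e.symm.surjective.comp Ideal.Quotient.mk_surjective, fun f => ?_⟩
  change e.symm (Ideal.Quotient.mk (almostZero U R) f) = 0 ↔ _
  rw [EmbeddingLike.map_eq_zero_iff, Ideal.Quotient.eq_zero_iff_mem, mem_almostZero]

namespace IsUltraproductMap

theorem map_eq_iff (hπ : IsUltraproductMap U π) {f g : ∀ w, R w} :
    π f = π g ↔ ∀ᶠ w in (U : Filter W), f w = g w := by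
  rw [← sub_eq_zero, ← map_sub, hπ.map_eq_zero_iff]
  simp only [Pi.sub_apply, sub_eq_zero]

theorem isUnit_iff (hπ : IsUltraproductMap U π) {f : ∀ w, R w} :
    IsUnit (π f) ↔ ∀ᶠ w in (U : Filter W), IsUnit (f w) := by
  constructor
  · intro h
    obtain ⟨b, hb⟩ := h.exists_right_inv
    obtain ⟨g, rfl⟩ := hπ.surjective b
    rw [← map_mul, ← map_one π, hπ.map_eq_iff] at hb
    exact hb.mono fun w hw => IsUnit.of_mul_eq_one _ hw
  · intro h
    obtain ⟨g, hg⟩ := exists_forall_of_eventually_exists (h.mono fun w hw => hw.exists_right_inv)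
    refine IsUnit.of_mul_eq_one (π g) ?_
    rw [← map_mul, ← map_one π, hπ.map_eq_iff]
    exact hg

theorem isUltraIdeal_maximalIdeal [∀ w, IsLocalRing (R w)] [IsLocalRing S]
    (hπ : IsUltraproductMap U π) :
    IsUltraIdeal U π (maximalIdeal S) fun w => maximalIdeal (R w) := by
  intro f
  simp only [mem_maximalIdeal, mem_nonunits_iff, hπ.isUnit_iff, Ultrafilter.eventually_not]

theorem isUltraIdeal_span (hπ : IsUltraproductMap U π) {ι : Type*} [Finite ι]
    (x : ι → ∀ w, R w) :
    IsUltraIdeal U π (Ideal.span (Set.range fun i => π (x i)))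
      fun w => Ideal.span (Set.range fun i => x i w) := by
  have := Fintype.ofFinite ι
  intro f
  simp only [Ideal.mem_span_range_iff_exists_fun]
  constructor
  · rintro ⟨c, hc⟩
    choose g hg using fun i => hπ.surjective (c i)
    simp only [← hg, ← map_mul, ← map_sum, hπ.map_eq_iff] at hc
    exact hc.mono fun w hw => ⟨fun i => g i w, by simpa using hw⟩
  · intro h
    obtain ⟨c, hc⟩ := exists_forall_of_eventually_exists h
    refine ⟨fun i => π fun w => c w i, ?_⟩
    simp only [← map_mul, ← map_sum, hπ.map_eq_iff]
    exact hc.mono fun w hw => by simpa using hw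

end IsUltraproductMap

namespace IsUltraIdeal

variable {P Q : Ideal S} {I J : ∀ w, Ideal (R w)}

theorem congr_right (hP : IsUltraIdeal U π P I) (h : ∀ᶠ w in (U : Filter W), I w = J w) :
    IsUltraIdeal U π P J := fun f => by
  rw [hP f]
  exact eventually_congr (h.mono fun w hw => by rw [hw])

theorem colon (hP : IsUltraIdeal U π P I) (a : ∀ w, R w) :
    IsUltraIdeal U π (Submodule.colon P {π a}) fun w => Submodule.colon (I w) {a w} := by
  intro f
  simp only [Submodule.mem_colon_singleton, smul_eq_mul, ← map_mul, hP _, Pi.mul_apply]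

theorem le_iff (hπ : IsUltraproductMap U π) (hP : IsUltraIdeal U π P I)
    (hQ : IsUltraIdeal U π Q J) : P ≤ Q ↔ ∀ᶠ w in (U : Filter W), I w ≤ J w := by
  constructor
  · intro h
    by_contra hcon
    rw [← Ultrafilter.eventually_not] at hcon
    simp only [SetLike.not_le_iff_exists] at hcon
    obtain ⟨f, hf⟩ := exists_forall_of_eventually_exists hcon
    have h1 := (hQ f).mp (h ((hP f).mpr (hf.mono fun w hw => hw.1)))
    obtain ⟨w, hw, hw'⟩ := (h1.and hf).exists
    exact hw'.2 hw
  · intro h a ha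
    obtain ⟨f, rfl⟩ := hπ.surjective a
    exact (hQ f).mpr (((hP f).mp ha).mp (h.mono fun w hw h => hw h))

theorem eq_iff (hπ : IsUltraproductMap U π) (hP : IsUltraIdeal U π P I)
    (hQ : IsUltraIdeal U π Q J) : P = Q ↔ ∀ᶠ w in (U : Filter W), I w = J w := by
  simp only [le_antisymm_iff, hP.le_iff hπ hQ, hQ.le_iff hπ hP, eventually_and]

theorem lt_iff (hπ : IsUltraproductMap U π) (hP : IsUltraIdeal U π P I)
    (hQ : IsUltraIdeal U π Q J) : P < Q ↔ ∀ᶠ w in (U : Filter W), I w < J w := by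
  simp only [lt_iff_le_not_ge, hP.le_iff hπ hQ, hQ.le_iff hπ hP, eventually_and,
    Ultrafilter.eventually_not]

theorem isPrime_iff (hπ : IsUltraproductMap U π) (hP : IsUltraIdeal U π P I) :
    P.IsPrime ↔ ∀ᶠ w in (U : Filter W), (I w).IsPrime := by
  have hone : (1 : S) ∈ P ↔ ∀ᶠ w in (U : Filter W), (1 : R w) ∈ I w := by
    rw [← map_one π]; exact hP 1
  simp only [Ideal.isPrime_iff, Ne, Ideal.eq_top_iff_one, eventually_and,
    Ultrafilter.eventually_not, hone]
  refine and_congr_right fun _ => ⟨fun h => ?_, fun h {a b} hab => ?_⟩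
  · by_contra hcon
    rw [← Ultrafilter.eventually_not] at hcon
    push Not at hcon
    obtain ⟨f, hf⟩ := exists_forall_of_eventually_exists hcon
    obtain ⟨g, hg⟩ := exists_forall_of_eventually_exists hf
    have := h (x := π f) (y := π g) (by
      rw [← map_mul]; exact (hP _).mpr (hg.mono fun w hw => hw.1))
    rw [hP, hP, ← Ultrafilter.eventually_or] at this
    obtain ⟨w, hw, hw'⟩ := (this.and hg).exists
    exact hw.elim hw'.2.1 hw'.2.2
  · obtain ⟨f, rfl⟩ := hπ.surjective a
    obtain ⟨g, rfl⟩ := hπ.surjective b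
    rw [← map_mul, hP] at hab
    rw [hP, hP, ← Ultrafilter.eventually_or]
    exact hab.mp (h.mono fun w hw => @hw _ _)

end IsUltraIdeal

/-- The ideal `P` of the ultraproduct is the ultraproduct of the ideals `I w`, all generated by
equally many elements. -/
def IsUltraIdealFG (U : Ultrafilter W) (π : (∀ w, R w) →+* S) (P : Ideal S)
    (I : ∀ w, Ideal (R w)) : Prop :=
  ∃ (k : ℕ) (x : Fin k → ∀ w, R w), P = Ideal.span (Set.range fun i => π (x i)) ∧
    ∀ᶠ w in (U : Filter W), I w = Ideal.span (Set.range fun i => x i w)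

namespace IsUltraIdealFG

variable {P Q : Ideal S} {I J : ∀ w, Ideal (R w)}

theorem of_finite {ι : Type*} [Finite ι] (x : ι → ∀ w, R w)
    (hP : P = Ideal.span (Set.range fun i => π (x i)))
    (hI : ∀ᶠ w in (U : Filter W), I w = Ideal.span (Set.range fun i => x i w)) :
    IsUltraIdealFG U π P I := by
  obtain ⟨k, ⟨e⟩⟩ := Finite.exists_equiv_fin ι
  refine ⟨k, fun i => x (e.symm i), ?_, ?_⟩
  · rw [hP]
    exact congrArg Ideal.span (e.symm.surjective.range_comp fun i => π (x i)).symm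
  · exact hI.mono fun w hw => by
      rw [hw]
      exact congrArg Ideal.span (e.symm.surjective.range_comp fun i => x i w).symm

theorem isUltraIdeal (hπ : IsUltraproductMap U π) (hP : IsUltraIdealFG U π P I) :
    IsUltraIdeal U π P I := by
  obtain ⟨k, x, rfl, hI⟩ := hP
  exact (hπ.isUltraIdeal_span x).congr_right (hI.mono fun w hw => hw.symm)

theorem fg (hP : IsUltraIdealFG U π P I) : P.FG := by
  obtain ⟨k, x, rfl, -⟩ := hP
  exact Submodule.fg_span (Set.finite_range _)

theorem mul (hP : IsUltraIdealFG U π P I) (hQ : IsUltraIdealFG U π Q J) :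
    IsUltraIdealFG U π (P * Q) fun w => I w * J w := by
  obtain ⟨k, x, rfl, hI⟩ := hP
  obtain ⟨l, y, rfl, hJ⟩ := hQ
  refine of_finite (fun p : Fin k × Fin l => x p.1 * y p.2) ?_ ?_
  · simp only [map_mul, span_range_mul_span_range]
  · filter_upwards [hI, hJ] with w h1 h2
    rw [h1, h2, span_range_mul_span_range]
    rfl

theorem sup (hP : IsUltraIdealFG U π P I) (hQ : IsUltraIdealFG U π Q J) :
    IsUltraIdealFG U π (P ⊔ Q) fun w => I w ⊔ J w := by
  obtain ⟨k, x, rfl, hI⟩ := hP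
  obtain ⟨l, y, rfl, hJ⟩ := hQ
  refine of_finite (Sum.elim x y) ?_ ?_
  · rw [← Ideal.span_union]
    congr 1
    ext z
    simp
  · filter_upwards [hI, hJ] with w h1 h2
    rw [h1, h2, ← Ideal.span_union]
    congr 1
    ext z
    simp

theorem pow (hP : IsUltraIdealFG U π P I) (n : ℕ) :
    IsUltraIdealFG U π (P ^ n) fun w => I w ^ n := by
  induction n with
  | zero =>
    refine of_finite (ι := Unit) (fun _ => 1) ?_ ?_
    · simp [Ideal.span_singleton_one]
    · simp [Ideal.span_singleton_one]
  | succ n ih => simpa only [pow_succ] using ih.mul hP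

end IsUltraIdealFG

theorem exists_isUltraIdealFG_of_fg (hπ : IsUltraproductMap U π) {J : Ideal S} (hJ : J.FG) :
    ∃ I, IsUltraIdealFG U π J I := by
  obtain ⟨k, x, rfl⟩ := Submodule.fg_iff_exists_fin_generating_family.mp hJ
  choose f hf using fun i => hπ.surjective (x i)
  exact ⟨_, k, f, by simp only [hf], Eventually.of_forall fun w => rfl⟩

end

/-! ### Koszul homology -/

section Koszul

variable {R : Type*} [CommRing R] {n : ℕ}

theorem koszulD_apply (x : Fin n → R) (c : Finset (Fin n) → R) (T : Finset (Fin n)) :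
    koszulD x c T = ∑ j ∈ Tᶜ, (-1) ^ (T.filter (· < j)).card * x j * c (insert j T) := rfl

theorem koszul_sign_swap {T : Finset (Fin n)} {j k : Fin n} (hj : j ∉ T) (hjk : j < k) :
    (-1 : R) ^ (T.filter (· < j)).card * (-1) ^ ((insert j T).filter (· < k)).card +
      (-1) ^ (T.filter (· < k)).card * (-1) ^ ((insert k T).filter (· < j)).card = 0 := by
  rw [Finset.filter_insert, if_pos hjk, Finset.filter_insert, if_neg hjk.not_gt,
    Finset.card_insert_of_notMem (by simp [hj]), pow_succ]
  ring

theorem koszulD_koszulD (x : Fin n → R) (c : Finset (Fin n) → R) :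
    koszulD x (koszulD x c) = 0 := by
  funext T
  simp only [koszulD_apply, Finset.mul_sum, Pi.zero_apply]
  rw [Finset.sum_sigma']
  have hterm : ∀ j k, j ∉ T → k ∉ T → j < k →
      (-1) ^ (T.filter (· < j)).card * x j * ((-1) ^ ((insert j T).filter (· < k)).card * x k *
        c (insert k (insert j T))) +
      (-1) ^ (T.filter (· < k)).card * x k * ((-1) ^ ((insert k T).filter (· < j)).card * x j *
        c (insert j (insert k T))) = 0 := by
    intro j k hj hk hjk
    rw [Finset.insert_comm j k]
    linear_combination (x j * x k * c (insert k (insert j T))) * koszul_sign_swap (R := R) hj hjk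
  refine Finset.sum_involution (fun p _ => ⟨p.2, p.1⟩) ?_ ?_ ?_ ?_
  · rintro ⟨j, k⟩ h
    simp only [Finset.mem_sigma, Finset.mem_compl, Finset.mem_insert, not_or] at h
    rcases lt_or_gt_of_ne h.2.1 with hlt | hlt
    · rw [add_comm]
      exact hterm k j h.2.2 h.1 hlt
    · exact hterm j k h.1 h.2.2 hlt
  · rintro ⟨j, k⟩ h - heq
    simp only [Finset.mem_sigma, Finset.mem_compl, Finset.mem_insert, not_or] at h
    exact h.2.1 (congrArg Sigma.fst heq)
  · rintro ⟨j, k⟩ h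
    simp only [Finset.mem_sigma, Finset.mem_compl, Finset.mem_insert, not_or] at h ⊢
    exact ⟨h.2.2, Ne.symm h.2.1, h.1⟩
  · intros; rfl

theorem koszulD_mem_koszulDeg (x : Fin n → R) {c : Finset (Fin n) → R} {i : ℕ}
    (hc : c ∈ koszulDeg R n (i + 1)) : koszulD x c ∈ koszulDeg R n i := by
  intro S hS
  rw [koszulD_apply]
  refine Finset.sum_eq_zero fun j hj => ?_
  rw [hc _ (by rw [Finset.card_insert_of_notMem (Finset.mem_compl.mp hj)]; omega), mul_zero]

theorem koszulD_eq_zero_of_mem_koszulDeg_zero (x : Fin n → R) {c : Finset (Fin n) → R}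
    (hc : c ∈ koszulDeg R n 0) : koszulD x c = 0 := by
  funext S
  rw [koszulD_apply]
  refine Finset.sum_eq_zero fun j hj => ?_
  rw [hc _ (by simp), mul_zero]

theorem eq_zero_of_mem_koszulDeg {c : Finset (Fin n) → R} {i : ℕ} (hi : n < i)
    (hc : c ∈ koszulDeg R n i) : c = 0 := by
  funext S
  refine hc S (ne_of_lt (lt_of_le_of_lt ?_ hi))
  simpa using S.card_le_univ

theorem koszulVanishes_of_lt (x : Fin n → R) {i : ℕ} (hi : n < i) : KoszulVanishes x i :=
  fun c hc _ => ⟨0, Submodule.zero_mem _, by rw [map_zero, eq_zero_of_mem_koszulDeg hi hc]⟩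

theorem koszulD_map {A : Type*} [CommRing A] (φ : R →+* A) (x : Fin n → R)
    (c : Finset (Fin n) → R) (T : Finset (Fin n)) :
    koszulD (fun j => φ (x j)) (fun S => φ (c S)) T = φ (koszulD x c T) := by
  simp [koszulD_apply, map_sum]

theorem koszulVanishes_of_lt_add_koszulGrade (x : Fin n → R) {i : ℕ} (hi : n < i + koszulGrade x) :
    KoszulVanishes x i := by
  by_contra hcon
  have hle : ∀ j ∈ {j : ℕ | ¬ KoszulVanishes x j}, j ≤ n := fun j hj => by
    by_contra h
    exact hj (koszulVanishes_of_lt x (not_le.mp h))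
  have h1 : i ≤ sSup {j : ℕ | ¬ KoszulVanishes x j} := le_csSup ⟨n, hle⟩ hcon
  have h2 : sSup {j : ℕ | ¬ KoszulVanishes x j} ≤ n := csSup_le' hle
  unfold koszulGrade at hi
  omega

/-- The top Koszul homology is the annihilator of the tuple. -/
theorem eq_zero_of_koszulVanishes_top {x : Fin n → R} (h : KoszulVanishes x n) {r : R}
    (hr : ∀ j, x j * r = 0) : r = 0 := by
  classical
  obtain ⟨b, hb, hbc⟩ := h (Pi.single Finset.univ r) (fun S hS => by
      rw [Pi.single_eq_of_ne]
      rintro rfl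
      simp at hS) (by
    funext T
    rw [koszulD_apply]
    refine Finset.sum_eq_zero fun j _ => ?_
    by_cases hT : insert j T = Finset.univ
    · rw [hT, Pi.single_eq_same, mul_assoc, hr, mul_zero]
    · rw [Pi.single_eq_of_ne hT, mul_zero])
  rw [eq_zero_of_mem_koszulDeg (Nat.lt_succ_self n) hb, map_zero] at hbc
  have := congrFun hbc Finset.univ
  rwa [Pi.zero_apply, Pi.single_eq_same, eq_comm] at this

/-- Reduction modulo a nonzerodivisor `y` lowers by one the degree from which on the Koszul
homology vanishes. -/
theorem koszulVanishes_quotient {x : Fin n → R} {y : R} (hy : y ∈ nonZeroDivisors R) {i : ℕ}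
    (h : ∀ j, i ≤ j + 1 → KoszulVanishes x j) :
    KoszulVanishes (fun j => Ideal.Quotient.mk (Ideal.span {y}) (x j)) i := by
  classical
  intro c' hc' hDc'
  have hlift : ∃ c ∈ koszulDeg R n i, ∀ S, Ideal.Quotient.mk (Ideal.span {y}) (c S) = c' S := by
    choose c hc using fun S => Ideal.Quotient.mk_surjective (c' S)
    refine ⟨fun S => if S.card = i then c S else 0, fun S hS => if_neg hS, fun S => ?_⟩
    dsimp only
    split_ifs with hS
    · exact hc S
    · rw [map_zero, hc' S hS]
  obtain ⟨c, hc, hcc⟩ := hlift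
  -- it suffices to correct the lifted chain by a multiple of `y` to a cycle
  suffices hsuff : ∃ e ∈ koszulDeg R n i, koszulD x (c - y • e) = 0 by
    obtain ⟨e, he, hDe⟩ := hsuff
    obtain ⟨f, hf, hDf⟩ := h i (Nat.le_succ i) (c - y • e)
      (Submodule.sub_mem _ hc (Submodule.smul_mem _ y he)) hDe
    refine ⟨fun S => Ideal.Quotient.mk (Ideal.span {y}) (f S), fun S hS => by
      dsimp only; rw [hf S hS, map_zero], ?_⟩
    funext T
    rw [koszulD_map, hDf, ← hcc T, Pi.sub_apply, map_sub, sub_eq_self, Pi.smul_apply, smul_eq_mul,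
      Ideal.Quotient.eq_zero_iff_mem]
    exact Ideal.mul_mem_right _ _ (Ideal.mem_span_singleton_self y)
  obtain _ | i := i
  · exact ⟨0, Submodule.zero_mem _, by
      rw [smul_zero, sub_zero]; exact koszulD_eq_zero_of_mem_koszulDeg_zero x hc⟩
  have hdvd : ∀ S, ∃ b, koszulD x c S = y * b := fun S => by
    have h0 : Ideal.Quotient.mk (Ideal.span {y}) (koszulD x c S) = 0 := by
      rw [← koszulD_map, show (fun S => Ideal.Quotient.mk (Ideal.span {y}) (c S)) = c' from
        funext hcc, hDc', Pi.zero_apply]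
    exact Ideal.mem_span_singleton.mp (Ideal.Quotient.eq_zero_iff_mem.mp h0)
  choose b hb using hdvd
  have hDc : koszulD x c = y • b := funext hb
  have hbdeg : b ∈ koszulDeg R n i := fun S hS => by
    have h0 := koszulD_mem_koszulDeg x hc S hS
    rw [hb, mul_comm] at h0
    exact (mem_nonZeroDivisors_iff.mp hy).2 _ h0
  have hDb : koszulD x b = 0 := by
    have h0 := koszulD_koszulD x c
    rw [hDc, map_smul] at h0
    funext S
    have h1 := congrFun h0 S
    rw [Pi.smul_apply, smul_eq_mul, mul_comm] at h1
    exact (mem_nonZeroDivisors_iff.mp hy).2 _ h1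
  obtain ⟨e, he, hDe⟩ := h i le_rfl b hbdeg hDb
  exact ⟨e, he, by rw [map_sub, map_smul, hDe, hDc, sub_self]⟩

end Koszul

/-- In a Noetherian local ring, if no non-zero element is annihilated by the maximal ideal, then the
maximal ideal contains a nonzerodivisor. -/
theorem exists_mem_maximalIdeal_mem_nonZeroDivisors {R : Type*} [CommRing R] [IsLocalRing R]
    [IsNoetherianRing R] (h : ∀ r : R, (∀ a ∈ maximalIdeal R, a * r = 0) → r = 0) :
    ∃ y ∈ maximalIdeal R, y ∈ nonZeroDivisors R := by
  by_contra! hcon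
  have hsub : (maximalIdeal R : Set R) ⊆ ⋃ p ∈ associatedPrimes R R, (p : Set R) := by
    rw [biUnion_associatedPrimes_eq_compl_nonZeroDivisors]
    exact hcon
  obtain ⟨p, hp, hle⟩ := (Ideal.subset_union_prime_finite (associatedPrimes.finite R R) ⊥ ⊥
    (fun p hp _ _ => hp.1)).mp hsub
  obtain ⟨hprime, r, hr⟩ := isAssociatedPrime_iff.mp hp
  have hr0 : r = 0 := h r fun a ha => by
    have := hle ha
    rw [hr, Submodule.mem_colon_singleton] at this
    exact this
  exact hprime.ne_top (by rw [hr, hr0]; ext; simp)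

/-- If the Koszul homology of a Noetherian local ring, on generators of its maximal ideal, vanishes
in the top `g` degrees, then the dimension of the ring is at least `g`: depth is at most
dimension. -/
theorem le_ringKrullDim_of_koszulVanishes {n : ℕ} (g : ℕ) : ∀ (R : Type*) [CommRing R]
    [IsLocalRing R] [IsNoetherianRing R] (x : Fin n → R),
    Ideal.span (Set.range x) = maximalIdeal R → (∀ i, n < i + g → KoszulVanishes x i) →
    ((g : ℕ∞) : WithBot ℕ∞) ≤ ringKrullDim R := by
  induction g with
  | zero => intro R _ _ _ x _ _; exact ringKrullDim_nonneg_of_nontrivial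
  | succ g ih =>
    intro R _ _ _ x hx h
    obtain ⟨y, hym, hy⟩ := exists_mem_maximalIdeal_mem_nonZeroDivisors fun r hr =>
      eq_zero_of_koszulVanishes_top (h n (by omega)) fun j =>
        hr _ (hx ▸ Ideal.subset_span ⟨j, rfl⟩)
    have : IsLocalRing (R ⧸ Ideal.span {y}) :=
      isLocalRing_quotient (by rwa [Ideal.span_singleton_le_iff_mem])
    have h1 := ih (R ⧸ Ideal.span {y}) (fun j => Ideal.Quotient.mk (Ideal.span {y}) (x j)) (by
      rw [← map_mk_maximalIdeal, ← hx, Ideal.map_span, ← Set.range_comp]; rfl)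
      fun i hi => koszulVanishes_quotient hy fun j hj => h j (by omega)
    refine le_trans ?_ (ringKrullDim_quotient_succ_le_of_nonZeroDivisor hy)
    push_cast
    exact add_le_add_left h1 1

/-- Vanishing of Koszul homology, a statement on finitely many linear equations, passes from the
ultraproduct to almost all of the rings. -/
theorem IsUltraproductMap.eventually_koszulVanishes {W : Type*} {U : Ultrafilter W}
    {R : W → Type*} [∀ w, CommRing (R w)] {S : Type*} [CommRing S] {π : (∀ w, R w) →+* S}
    (hπ : IsUltraproductMap U π) {n : ℕ} (x : Fin n → ∀ w, R w) {i : ℕ}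
    (h : KoszulVanishes (fun j => π (x j)) i) :
    ∀ᶠ w in (U : Filter W), KoszulVanishes (fun j => x j w) i := by
  by_contra hcon
  rw [← Ultrafilter.eventually_not] at hcon
  simp only [KoszulVanishes, not_forall] at hcon
  obtain ⟨c, hc⟩ := exists_forall_of_eventually_exists hcon
  have hD : ∀ (f : Finset (Fin n) → ∀ w, R w) T,
      koszulD (fun j => π (x j)) (fun S => π (f S)) T =
        π fun w => koszulD (fun j => x j w) (fun S => f S w) T := fun f T => by
    rw [koszulD_map]
    congr 1
    funext w
    exact (koszulD_map (Pi.evalRingHom R w) x f T).symm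
  obtain ⟨b, hb, hbc⟩ := h (fun S => π fun w => c w S)
    (fun S hS => (hπ.map_eq_zero_iff _).mpr (hc.mono fun w hw => by
      obtain ⟨h1, -⟩ := hw
      exact h1 S hS))
    (by
      funext T
      rw [hD fun S w => c w S]
      refine (hπ.map_eq_zero_iff _).mpr (hc.mono fun w hw => ?_)
      obtain ⟨-, h2, -⟩ := hw
      exact congrFun h2 T)
  have hlift : ∃ f : Finset (Fin n) → ∀ w, R w, (∀ S, π (f S) = b S) ∧
      ∀ S, S.card ≠ i + 1 → f S = 0 := by
    classical
    choose f hf using fun S => hπ.surjective (b S)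
    refine ⟨fun S => if S.card = i + 1 then f S else 0, fun S => ?_, fun S hS => if_neg hS⟩
    dsimp only
    split_ifs with hS
    · exact hf S
    · rw [map_zero, hb S hS]
  obtain ⟨f, hf, hf0⟩ := hlift
  have hfc : ∀ᶠ w in (U : Filter W), ∀ T,
      koszulD (fun j => x j w) (fun S => f S w) T = c w T := by
    rw [eventually_all]
    intro T
    rw [← hπ.map_eq_iff, ← hD]
    simp only [hf, hbc]
  obtain ⟨w, hw, hw'⟩ := (hfc.and hc).exists
  obtain ⟨-, -, h3⟩ := hw'
  exact h3 ⟨fun S => f S w, fun S hS => by dsimp only; rw [hf0 S hS]; rfl, funext hw⟩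

/-! ### Closed and associated primes in Noetherian local rings -/

theorem exists_span_range_eq_maximalIdeal_of_embDim_le {R : Type*} [CommRing R] [IsLocalRing R]
    {m : ℕ} (h : embDim R ≤ m) :
    ∃ x : Fin m → R, Ideal.span (Set.range x) = maximalIdeal R := by
  by_contra! hcon
  have h1 : ((m + 1 : ℕ) : ℕ∞) ≤ embDim R := by
    refine le_iInf₂ fun n hn => ?_
    obtain ⟨x, hx⟩ := hn
    rw [Nat.cast_le]
    by_contra hlt
    obtain ⟨y, hy⟩ := exists_span_range_fin_eq (by omega : n ≤ m) x
    exact hcon y (hy.trans hx)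
  have := h1.trans h
  rw [Nat.cast_le] at this
  omega

/-- In a Noetherian local ring, every ideal is closed: Krull's intersection theorem. -/
theorem mem_of_forall_mem_sup_pow {R : Type*} [CommRing R] [IsLocalRing R] [IsNoetherianRing R]
    {J : Ideal R} {a : R} (h : ∀ n, a ∈ J ⊔ maximalIdeal R ^ n) : a ∈ J := by
  rw [← Ideal.Quotient.eq_zero_iff_mem]
  refine IsHausdorff.haus (I := maximalIdeal R) (M := R ⧸ J) inferInstance _ fun n => ?_
  rw [SModEq.zero]
  obtain ⟨j, hj, b, hb, rfl⟩ := Submodule.mem_sup.mp (h n)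
  rw [map_add, Ideal.Quotient.eq_zero_iff_mem.mpr hj, zero_add]
  have : b • (1 : R ⧸ J) ∈ (maximalIdeal R ^ n • ⊤ : Submodule R (R ⧸ J)) :=
    Submodule.smul_mem_smul hb trivial
  rwa [Algebra.smul_def, mul_one] at this

theorem isAssocPrime_of_mem_minimalPrimes {R : Type*} [CommRing R] [IsNoetherianRing R]
    {p J : Ideal R} (hp : p ∈ J.minimalPrimes) : IsAssocPrime p J := by
  refine ⟨hp.1.1, Submodule.exists_eq_colon_of_mem_minimalPrimes (x := (1 : R)) ?_⟩
  have : Submodule.colon J {(1 : R)} = J := by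
    ext; simp [Submodule.mem_colon_singleton]
  rwa [this]

theorem IsAssocPrime.le {R : Type*} [CommRing R] {p J : Ideal R} (hp : IsAssocPrime p J) :
    J ≤ p := by
  obtain ⟨-, a, rfl⟩ := hp
  intro b hb
  rw [Submodule.mem_colon_singleton, smul_eq_mul]
  exact Ideal.mul_mem_right _ _ hb

/-- In a Noetherian local ring, an ideal whose only associated prime is the maximal ideal contains a
power of it. -/
theorem IsMinimalAssocPrime.exists_pow_le {R : Type*} [CommRing R] [IsLocalRing R]
    [IsNoetherianRing R] {J : Ideal R} (h : IsMinimalAssocPrime (maximalIdeal R) J) :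
    ∃ N, maximalIdeal R ^ N ≤ J := by
  refine exists_maximalIdeal_pow_le ⟨⟨inferInstance, h.1.le⟩, fun q hq hqm => ?_⟩
  have := hq.1
  obtain ⟨p, hp, hpq⟩ := Ideal.exists_minimalPrimes_le hq.2
  by_contra hcon
  exact h.2 p (isAssocPrime_of_mem_minimalPrimes hp)
    (lt_of_le_of_lt hpq (lt_of_le_not_ge hqm hcon))

theorem isMinimalAssocPrime_maximalIdeal {R : Type*} [CommRing R] [IsLocalRing R]
    [IsNoetherianRing R] {J : Ideal R} (hJ : J ≤ maximalIdeal R) {N : ℕ}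
    (hN : maximalIdeal R ^ N ≤ J) : IsMinimalAssocPrime (maximalIdeal R) J := by
  have hmin := maximalIdeal_mem_minimalPrimes hJ hN
  refine ⟨isAssocPrime_of_mem_minimalPrimes hmin, fun q hq hlt => ?_⟩
  exact hlt.not_ge (hmin.2 ⟨hq.1, hq.le⟩ hlt.le)

/-! ### Finitely related primes of an ultraproduct -/

section

variable {W : Type*} {U : Ultrafilter W} {R : W → Type*} [∀ w, CommRing (R w)]
  [∀ w, IsLocalRing (R w)] {S : Type*} [CommRing S] {π : (∀ w, R w) →+* S}

/-- The fr-dimension of the ultraproduct is the common dimension of the factors. Finitely related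
primes are ultraproducts of primes, which bounds their chains; conversely a prime of height at most
`h` is associated to an ideal with `h` generators, and this bound is uniform in the factors. -/
theorem frDim_eq [∀ w, IsNoetherianRing (R w)] (hπ : IsUltraproductMap U π) {h : ℕ}
    (hh : ∀ᶠ w in (U : Filter W), ringKrullDim (R w) = ((h : ℕ∞) : WithBot ℕ∞)) :
    frDim S = ((h : ℕ∞) : WithBot ℕ∞) := by
  refine le_antisymm ?_ ?_
  · refine iSup_le fun c => ?_
    have hex : ∀ i, ∃ I : ∀ w, Ideal (R w), IsUltraIdeal U π (c i).1.asIdeal I := by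
      intro i
      obtain ⟨J, hJ, -, s, hs⟩ := (c i).2
      obtain ⟨I, hI⟩ := exists_isUltraIdealFG_of_fg hπ hJ
      obtain ⟨a, rfl⟩ := hπ.surjective s
      exact ⟨_, hs ▸ (hI.isUltraIdeal hπ).colon a⟩
    choose I hI using hex
    have hprime : ∀ᶠ w in (U : Filter W), ∀ i, (I i w).IsPrime :=
      eventually_all.mpr fun i => ((hI i).isPrime_iff hπ).mp (c i).1.isPrime
    have hlt : ∀ᶠ w in (U : Filter W), ∀ i : Fin c.length, I i.castSucc w < I i.succ w :=
      eventually_all.mpr fun i => ((hI _).lt_iff hπ (hI _)).mp (c.step i)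
    obtain ⟨w, hw1, hw2, hw3⟩ := (hh.and (hprime.and hlt)).exists
    rw [← hw1]
    exact Order.LTSeries.length_le_krullDim
      (⟨c.length, fun i => ⟨I i w, hw2 i⟩, hw3⟩ : LTSeries (PrimeSpectrum (R w)))
  · -- A chain of primes of length `h` in `R w`; each is minimal over an ideal with `h` generators.
    have hex : ∀ᶠ w in (U : Filter W), ∃ d : Fin (h + 1) → (Fin h → R w) × R w,
        (∀ i, (Submodule.colon (Ideal.span (Set.range (d i).1)) {(d i).2}).IsPrime) ∧
        ∀ i : Fin h, Submodule.colon (Ideal.span (Set.range (d i.castSucc).1)) {(d i.castSucc).2} <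
          Submodule.colon (Ideal.span (Set.range (d i.succ).1)) {(d i.succ).2} := by
      filter_upwards [hh] with w hw
      obtain ⟨c, hc⟩ := Order.le_krullDim_iff.mp hw.ge
      have hd : ∀ i : Fin (c.length + 1), ∃ d : (Fin h → R w) × R w,
          (c i).asIdeal = Submodule.colon (Ideal.span (Set.range d.1)) {d.2} := by
        intro i
        obtain ⟨s, hs, hcard⟩ :=
          Ideal.exists_finset_card_eq_height_of_isNoetherianRing (c i).asIdeal
        have hle : s.card ≤ h := by
          have := (Ideal.height_le_ringKrullDim_of_ne_top (c i).isPrime.ne_top).trans_eq hw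
          rwa [← hcard, WithBot.coe_le_coe, Nat.cast_le] at this
        obtain ⟨x, hx⟩ := exists_span_range_fin_eq_finset s hle
        rw [← hx] at hs
        obtain ⟨-, a, ha⟩ := isAssocPrime_of_mem_minimalPrimes hs
        exact ⟨⟨x, a⟩, ha⟩
      choose d hd using hd
      subst hc
      refine ⟨d, fun i => hd i ▸ (c i).isPrime, fun i => ?_⟩
      rw [← hd, ← hd]
      exact c.step i
    obtain ⟨d, hd⟩ := exists_forall_of_eventually_exists hex
    let P : Fin (h + 1) → Ideal S := fun i => Submodule.colon
      (Ideal.span (Set.range fun j => π fun w => (d w i).1 j)) {π fun w => (d w i).2}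
    have hP : ∀ i, IsUltraIdeal U π (P i) fun w =>
        Submodule.colon (Ideal.span (Set.range (d w i).1)) {(d w i).2} := fun i =>
      (hπ.isUltraIdeal_span fun j w => (d w i).1 j).colon _
    have hprime : ∀ i, (P i).IsPrime := fun i =>
      ((hP i).isPrime_iff hπ).mpr (hd.mono fun w hw => hw.1 i)
    let c : LTSeries {p : PrimeSpectrum S // ∃ J : Ideal S, J.FG ∧ IsAssocPrime p.asIdeal J} :=
      ⟨h, fun i => ⟨⟨P i, hprime i⟩, _, Submodule.fg_span (Set.finite_range _), hprime i, _, rfl⟩,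
        fun i => ((hP i.castSucc).lt_iff hπ (hP i.succ)).mpr (hd.mono fun w hw => hw.2 i)⟩
    exact Order.LTSeries.length_le_krullDim c

end

/-! ### Dimensions of an ultraproduct of local rings -/

section

variable {W : Type*} {U : Ultrafilter W} {R : W → Type*} [∀ w, CommRing (R w)]
  [∀ w, IsLocalRing (R w)] {S : Type*} [CommRing S] [IsLocalRing S] {π : (∀ w, R w) →+* S}

theorem IsUltraproductMap.isUltraIdealFG_maximalIdeal (hπ : IsUltraproductMap U π) {m : ℕ}
    (hm : ∀ᶠ w in (U : Filter W), embDim (R w) ≤ (m : ℕ∞)) :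
    IsUltraIdealFG U π (maximalIdeal S) fun w => maximalIdeal (R w) := by
  obtain ⟨x, hx⟩ := exists_forall_of_eventually_exists
    (hm.mono fun w hw => exists_span_range_eq_maximalIdeal_of_embDim_le hw)
  refine ⟨m, fun i w => x w i, ?_, hx.mono fun w hw => hw.symm⟩
  exact (hπ.isUltraIdeal_maximalIdeal.eq_iff hπ (hπ.isUltraIdeal_span _)).mpr
    (hx.mono fun w hw => hw.symm)

theorem exists_ringKrullDim_eq [∀ w, IsNoetherianRing (R w)] {m : ℕ}
    (hm : ∀ᶠ w in (U : Filter W), embDim (R w) ≤ (m : ℕ∞)) :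
    ∃ h : ℕ, ∀ᶠ w in (U : Filter W), ringKrullDim (R w) = ((h : ℕ∞) : WithBot ℕ∞) := by
  have h1 : ∀ᶠ w in (U : Filter W), ∃ h : Fin (m + 1),
      ringKrullDim (R w) = (((h : ℕ) : ℕ∞) : WithBot ℕ∞) := by
    filter_upwards [hm] with w hw
    obtain ⟨x, hx⟩ := exists_span_range_eq_maximalIdeal_of_embDim_le hw
    have hle : ringKrullDim (R w) ≤ ((m : ℕ∞) : WithBot ℕ∞) :=
      (ringKrullDim_le_iff m).mpr ⟨x, fun i => hx ▸ Ideal.subset_span ⟨i, rfl⟩, 1, by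
        rw [pow_one, hx]⟩
    rw [← IsLocalRing.maximalIdeal_height_eq_ringKrullDim] at hle ⊢
    rw [WithBot.coe_le_coe] at hle
    obtain ⟨n, hn⟩ := ENat.ne_top_iff_exists.mp (ne_top_of_le_ne_top (ENat.natCast_ne_top m) hle)
    rw [← hn, Nat.cast_le] at hle
    exact ⟨⟨n, by omega⟩, by rw [← hn]⟩
  rw [Ultrafilter.eventually_exists_iff] at h1
  obtain ⟨h, hh⟩ := h1
  exact ⟨h, hh⟩

/-- That the maximal ideal is a minimal associated prime of an ideal with given generators holds in
the ultraproduct if and only if it holds in almost all of the factors. -/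
theorem isMinimalAssocPrime_span_iff (hπ : IsUltraproductMap U π) {d : ℕ} (x : Fin d → ∀ w, R w) :
    IsMinimalAssocPrime (maximalIdeal S) (Ideal.span (Set.range fun i => π (x i))) ↔
      ∀ᶠ w in (U : Filter W), IsMinimalAssocPrime (maximalIdeal (R w))
        (Ideal.span (Set.range fun i => x i w)) := by
  have hJ := hπ.isUltraIdeal_span x
  have hmax := hπ.isUltraIdeal_maximalIdeal
  have hex : (∃ s : S, maximalIdeal S =
      Submodule.colon (Ideal.span (Set.range fun i => π (x i))) {s}) ↔
      ∀ᶠ w in (U : Filter W), ∃ a : R w, maximalIdeal (R w) =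
        Submodule.colon (Ideal.span (Set.range fun i => x i w)) {a} := by
    constructor
    · rintro ⟨s, hs⟩
      obtain ⟨a, rfl⟩ := hπ.surjective s
      exact ((hmax.eq_iff hπ (hJ.colon a)).mp hs).mono fun w hw => ⟨a w, hw⟩
    · intro hev
      obtain ⟨a, ha⟩ := exists_forall_of_eventually_exists hev
      exact ⟨π a, (hmax.eq_iff hπ (hJ.colon a)).mpr ha⟩
  have hno : (∃ q : Ideal S, IsAssocPrime q (Ideal.span (Set.range fun i => π (x i))) ∧
      q < maximalIdeal S) ↔ ∀ᶠ w in (U : Filter W), ∃ q : Ideal (R w),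
        IsAssocPrime q (Ideal.span (Set.range fun i => x i w)) ∧ q < maximalIdeal (R w) := by
    constructor
    · rintro ⟨q, ⟨hq, s, rfl⟩, hlt⟩
      obtain ⟨a, rfl⟩ := hπ.surjective s
      filter_upwards [((hJ.colon a).isPrime_iff hπ).mp hq, ((hJ.colon a).lt_iff hπ hmax).mp hlt]
        with w h1 h2
      exact ⟨_, ⟨h1, a w, rfl⟩, h2⟩
    · intro hev
      obtain ⟨a, ha⟩ := exists_forall_of_eventually_exists (hev.mono fun w hw =>
        (show ∃ a : R w, (Submodule.colon (Ideal.span (Set.range fun i => x i w)) {a}).IsPrime ∧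
          Submodule.colon (Ideal.span (Set.range fun i => x i w)) {a} < maximalIdeal (R w) by
        obtain ⟨q, ⟨hq, a, rfl⟩, hlt⟩ := hw
        exact ⟨a, hq, hlt⟩))
      exact ⟨_, ⟨((hJ.colon a).isPrime_iff hπ).mpr (ha.mono fun w hw => hw.1), π a, rfl⟩,
        ((hJ.colon a).lt_iff hπ hmax).mpr (ha.mono fun w hw => hw.2)⟩
  have hno' := hno.not
  rw [← Ultrafilter.eventually_not] at hno'
  push Not at hno'
  have hprime : ∀ w, (maximalIdeal (R w)).IsPrime := fun w => inferInstance
  simp only [IsMinimalAssocPrime, eventually_and, hno']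
  refine and_congr_left fun _ => ?_
  simp only [IsAssocPrime, hprime, true_and, ← hex]
  exact and_iff_right inferInstance

/-- The pi-dimension of the ultraproduct is the common dimension of the factors: in a Noetherian
local ring, the maximal ideal is a minimal associated prime of precisely the ideals that are primary
to it. -/
theorem piDim_eq [∀ w, IsNoetherianRing (R w)] (hπ : IsUltraproductMap U π) {h : ℕ}
    (hh : ∀ᶠ w in (U : Filter W), ringKrullDim (R w) = ((h : ℕ∞) : WithBot ℕ∞)) :
    piDim S = h := by
  refine le_antisymm ?_ (le_iInf₂ fun d hd => ?_)
  · obtain ⟨x, hx⟩ := exists_forall_of_eventually_exists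
      (hh.mono fun w hw => (ringKrullDim_le_iff h).mp hw.le)
    refine iInf₂_le h ⟨fun i => π fun w => x w i, (isMinimalAssocPrime_span_iff hπ _).mpr ?_⟩
    filter_upwards [hx] with w hw
    obtain ⟨hmem, N, hN⟩ := hw
    refine isMinimalAssocPrime_maximalIdeal ?_ hN
    rw [Ideal.span_le]
    rintro _ ⟨i, rfl⟩
    exact hmem i
  · obtain ⟨y, hy⟩ := hd
    choose x hx using fun i => hπ.surjective (y i)
    rw [← funext hx] at hy
    obtain ⟨w, hw, hw'⟩ := (((isMinimalAssocPrime_span_iff hπ x).mp hy).and hh).exists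
    obtain ⟨N, hN⟩ := hw.exists_pow_le
    have h1 := (ringKrullDim_le_iff d).mpr
      ⟨fun i => x i w, fun i => hw.1.le (Ideal.subset_span ⟨i, rfl⟩), N, hN⟩
    rwa [hw', WithBot.coe_le_coe] at h1

theorem depth_le [∀ w, IsNoetherianRing (R w)] (hπ : IsUltraproductMap U π) {h : ℕ}
    (hh : ∀ᶠ w in (U : Filter W), ringKrullDim (R w) = ((h : ℕ∞) : WithBot ℕ∞)) :
    depth S ≤ h := by
  refine iSup_le fun n => iSup₂_le fun y hy => ?_
  choose x hx using fun i => hπ.surjective (y i)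
  obtain rfl := funext hx
  have hgen := ((hπ.isUltraIdeal_span x).eq_iff hπ hπ.isUltraIdeal_maximalIdeal).mp hy
  have hvan : ∀ᶠ w in (U : Filter W), ∀ i : Fin (n + 1),
      n < (i : ℕ) + koszulGrade (fun j => π (x j)) → KoszulVanishes (fun j => x j w) i := by
    refine eventually_all.mpr fun i => ?_
    by_cases hi : n < (i : ℕ) + koszulGrade (fun j => π (x j))
    · exact (hπ.eventually_koszulVanishes x (koszulVanishes_of_lt_add_koszulGrade _ hi)).mono
        fun w hw _ => hw
    · exact Eventually.of_forall fun w h => absurd h hi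
  obtain ⟨w, hw1, hw2, hw3⟩ := (hgen.and (hvan.and hh)).exists
  rw [← WithBot.coe_le_coe, ← hw3]
  refine le_ringKrullDim_of_koszulVanishes _ (R w) (fun j => x j w) hw1 fun i hi => ?_
  rcases lt_or_ge n i with hlt | hge
  · exact koszulVanishes_of_lt _ hlt
  · exact hw2 ⟨i, by omega⟩ hi

theorem le_pseudoDim [∀ w, IsNoetherianRing (R w)] (hπ : IsUltraproductMap U π)
    (hmax : IsUltraIdealFG U π (maximalIdeal S) fun w => maximalIdeal (R w)) {h : ℕ}
    (hh : ∀ᶠ w in (U : Filter W), ringKrullDim (R w) = ((h : ℕ∞) : WithBot ℕ∞)) :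
    (h : ℕ∞) ≤ pseudoDim S := by
  refine le_iInf₂ fun d hd => ?_
  obtain ⟨y, hy, N, hN⟩ := (pseudoDimLE_iff d S hmax.fg).mp hd
  choose x hx using fun i => hπ.surjective (y i)
  obtain rfl := funext hx
  have hmem : ∀ᶠ w in (U : Filter W), ∀ i, x i w ∈ maximalIdeal (R w) :=
    eventually_all.mpr fun i => (hπ.isUltraIdeal_maximalIdeal _).mp (hy i)
  have hpow := (((hmax.pow N).isUltraIdeal hπ).le_iff hπ (hπ.isUltraIdeal_span x)).mp hN
  obtain ⟨w, hw1, hw2, hw3⟩ := (hmem.and (hpow.and hh)).exists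
  rw [← WithBot.coe_le_coe, ← hw3]
  exact (ringKrullDim_le_iff d).mpr ⟨fun i => x i w, hw1, N, hw2⟩

/-! ### Closed primes of an ultraproduct -/

/-- Finitely generated ideals of the ultraproduct are closed, up to the intersection of the powers
of the maximal ideal. This holds for every ultrafilter, countably incomplete or not. -/
theorem IsUltraIdealFG.iInf_sup_pow_le [∀ w, IsNoetherianRing (R w)] (hπ : IsUltraproductMap U π)
    (hmax : IsUltraIdealFG U π (maximalIdeal S) fun w => maximalIdeal (R w))
    {J : Ideal S} {I : ∀ w, Ideal (R w)} (hJ : IsUltraIdealFG U π J I) :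
    ⨅ n : ℕ, J ⊔ maximalIdeal S ^ n ≤ J ⊔ ⨅ n : ℕ, maximalIdeal S ^ n := by
  intro s hs
  obtain ⟨a, rfl⟩ := hπ.surjective s
  rw [Ideal.mem_iInf] at hs
  -- In each factor, split off the part of `a w` in `I w` so that the rest is as small as possible.
  have key : ∀ w, ∃ c : R w, a w - c ∈ I w ∧
      ∀ n, a w ∈ I w ⊔ maximalIdeal (R w) ^ n → c ∈ maximalIdeal (R w) ^ n := by
    classical
    intro w
    by_cases hall : ∀ n, a w ∈ I w ⊔ maximalIdeal (R w) ^ n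
    · exact ⟨0, by simpa using mem_of_forall_mem_sup_pow hall, fun n _ => Ideal.zero_mem _⟩
    · push Not at hall
      obtain ⟨N, hN⟩ : ∃ N, Nat.find hall = N + 1 := by
        refine Nat.exists_eq_succ_of_ne_zero fun h0 => Nat.find_spec hall ?_
        rw [h0]; simp
      have hmem : a w ∈ I w ⊔ maximalIdeal (R w) ^ N := by
        by_contra hcon
        have := Nat.find_min' hall hcon
        omega
      obtain ⟨b, hb, c, hc, hbc⟩ := Submodule.mem_sup.mp hmem
      refine ⟨c, by rwa [← hbc, add_sub_cancel_right], fun n hn => ?_⟩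
      refine Ideal.pow_le_pow_right ?_ hc
      by_contra hlt
      refine Nat.find_spec hall ?_
      exact (sup_le_sup_left (Ideal.pow_le_pow_right (by omega)) (I w) :
        I w ⊔ maximalIdeal (R w) ^ n ≤ _) hn
  choose c hc1 hc2 using key
  rw [← sub_add_cancel (π a) (π c)]
  refine Ideal.add_mem _ (Ideal.mem_sup_left ?_) (Ideal.mem_sup_right ?_)
  · rw [← map_sub, hJ.isUltraIdeal hπ]
    exact Eventually.of_forall hc1
  · rw [Ideal.mem_iInf]
    intro n
    rw [(hmax.pow n).isUltraIdeal hπ]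
    exact (((hJ.sup (hmax.pow n)).isUltraIdeal hπ a).mp (hs n)).mono fun w hw => hc2 w n hw

/-- An ideal containing all elements infinitely close to zero is finitely generated up to
these. -/
theorem exists_fg_eq_sup_iInf_pow [∀ w, IsNoetherianRing (R w)] (hπ : IsUltraproductMap U π)
    (hmax : IsUltraIdealFG U π (maximalIdeal S) fun w => maximalIdeal (R w)) {P : Ideal S}
    (hP : ⨅ n : ℕ, maximalIdeal S ^ n ≤ P) :
    ∃ J : Ideal S, J.FG ∧ P = J ⊔ ⨅ n : ℕ, maximalIdeal S ^ n ∧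
      ⨅ n : ℕ, J ⊔ maximalIdeal S ^ n ≤ P := by
  have : IsNoetherianRing (S ⧸ maximalIdeal S) :=
    inferInstanceAs (IsNoetherianRing (ResidueField S))
  obtain ⟨J, hJP, hJ, hle⟩ := exists_fg_le_sup_pow (maximalIdeal S) hmax.fg P
  obtain ⟨I, hI⟩ := exists_isUltraIdealFG_of_fg hπ hJ
  have h1 := hmax.iInf_sup_pow_le hπ hI
  exact ⟨J, hJ, le_antisymm ((le_iInf hle).trans h1) (sup_le hJP hP), h1.trans (sup_le hJP hP)⟩

/-- The closed ideals are those containing all elements infinitely close to zero. -/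
theorem isClosedIdeal_iff [∀ w, IsNoetherianRing (R w)] (hπ : IsUltraproductMap U π)
    (hmax : IsUltraIdealFG U π (maximalIdeal S) fun w => maximalIdeal (R w)) {P : Ideal S} :
    IsClosedIdeal P ↔ ⨅ n : ℕ, maximalIdeal S ^ n ≤ P := by
  constructor
  · intro h
    rw [h]
    exact iInf_mono fun n => le_sup_right
  · intro h
    obtain ⟨J, -, hPJ, hle⟩ := exists_fg_eq_sup_iInf_pow hπ hmax h
    refine le_antisymm (le_iInf fun n => le_sup_left) (le_trans (iInf_mono fun n => ?_) hle)
    rw [hPJ]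
    exact sup_le (sup_le le_sup_left ((iInf_le _ n).trans le_sup_right)) le_sup_right

/-- The separated quotient of the ultraproduct is Noetherian. -/
theorem isNoetherianRing_quotient_iInf_pow [∀ w, IsNoetherianRing (R w)]
    (hπ : IsUltraproductMap U π)
    (hmax : IsUltraIdealFG U π (maximalIdeal S) fun w => maximalIdeal (R w)) :
    IsNoetherianRing (S ⧸ ⨅ n : ℕ, maximalIdeal S ^ n) := by
  refine (isNoetherianRing_iff_ideal_fg _).mpr fun P => ?_
  have hle : ⨅ n : ℕ, maximalIdeal S ^ n ≤ P.comap (Ideal.Quotient.mk _) := by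
    intro a ha
    rw [Ideal.mem_comap, Ideal.Quotient.eq_zero_iff_mem.mpr ha]
    exact Ideal.zero_mem _
  obtain ⟨J, hJ, hPJ, -⟩ := exists_fg_eq_sup_iInf_pow hπ hmax hle
  have h := congrArg (Ideal.map (Ideal.Quotient.mk (⨅ n : ℕ, maximalIdeal S ^ n))) hPJ
  rw [Ideal.map_comap_of_surjective _ Ideal.Quotient.mk_surjective, Ideal.map_sup,
    Ideal.map_quotient_self, sup_bot_eq] at h
  rw [h]
  exact hJ.map _

/-- Both invariants equal the Krull dimension of the Noetherian local ring `S / ⋂ 𝔪 ^ n`. -/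
theorem clDim_eq_pseudoDim [∀ w, IsNoetherianRing (R w)] (hπ : IsUltraproductMap U π)
    (hmax : IsUltraIdealFG U π (maximalIdeal S) fun w => maximalIdeal (R w)) :
    clDim S = (pseudoDim S : WithBot ℕ∞) := by
  have := isNoetherianRing_quotient_iInf_pow hπ hmax
  have hle : ⨅ n : ℕ, maximalIdeal S ^ n ≤ maximalIdeal S :=
    (iInf_le _ 1).trans (pow_one _).le
  have := isLocalRing_quotient hle
  have hcomap : ∀ n a, Ideal.Quotient.mk (⨅ n : ℕ, maximalIdeal S ^ n) a ∈
      maximalIdeal (S ⧸ ⨅ n : ℕ, maximalIdeal S ^ n) ^ n → a ∈ maximalIdeal S ^ n := by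
    intro n a ha
    rw [← map_mk_maximalIdeal, ← Ideal.map_pow, ← Ideal.mem_comap,
      Ideal.comap_map_of_surjective _ Ideal.Quotient.mk_surjective, ← RingHom.ker_eq_comap_bot,
      Ideal.mk_ker, sup_eq_left.mpr (iInf_le _ n)] at ha
    exact ha
  rw [pseudoDim_eq_ringKrullDim (pseudoDimLE_iff_ringKrullDim_le hmax.fg
    (Ideal.Quotient.mk (⨅ n : ℕ, maximalIdeal S ^ n)) (map_mk_maximalIdeal _)
    (fun n b => by
      obtain ⟨a, rfl⟩ := Ideal.Quotient.mk_surjective b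
      exact ⟨a, by rw [sub_self]; exact Ideal.zero_mem _⟩) hcomap),
    ringKrullDim_quotient, clDim]
  have hset : {p : PrimeSpectrum S | IsClosedIdeal p.asIdeal} =
      PrimeSpectrum.zeroLocus (⨅ n : ℕ, maximalIdeal S ^ n : Ideal S) :=
    Set.ext fun p => isClosedIdeal_iff hπ hmax
  exact congrArg (fun s : Set (PrimeSpectrum S) => Order.krullDim s) hset

end

end UltraNoeth

end

theorem theorem5p10 {W : Type*} (U : Ultrafilter W) (R : W → Type*)
    [∀ i, CommRing (R i)] [∀ i, IsLocalRing (R i)] [∀ i, IsNoetherianRing (R i)]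
    (m : ℕ) (hm : ∀ᶠ i in (U : Filter W), UltraNoeth.embDim (R i) ≤ (m : ℕ∞))
    (S : Type*) [CommRing S] [IsLocalRing S] (e : S ≃+* UltraNoeth.Ultraproduct U R) :
    ∃ h : ℕ, (∀ᶠ i in (U : Filter W), ringKrullDim (R i) = ((h : ℕ∞) : WithBot ℕ∞)) ∧
      UltraNoeth.depth S ≤ UltraNoeth.piDim S ∧
      (UltraNoeth.piDim S : WithBot ℕ∞) = UltraNoeth.frDim S ∧
      UltraNoeth.frDim S = ((h : ℕ∞) : WithBot ℕ∞) ∧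
      ((h : ℕ∞) : WithBot ℕ∞) ≤ UltraNoeth.clDim S ∧
      UltraNoeth.clDim S = (UltraNoeth.pseudoDim S : WithBot ℕ∞) ∧
      (UltraNoeth.pseudoDim S : WithBot ℕ∞) = UltraNoeth.cataDim S ∧
      UltraNoeth.cataDim S ≤ (UltraNoeth.embDim S : WithBot ℕ∞) := by
  obtain ⟨π, hπ⟩ := UltraNoeth.exists_isUltraproductMap U R e
  have hmax := hπ.isUltraIdealFG_maximalIdeal hm
  obtain ⟨h, hh⟩ := UltraNoeth.exists_ringKrullDim_eq hm
  have hpi := UltraNoeth.piDim_eq hπ hh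
  have hfr := UltraNoeth.frDim_eq hπ hh
  have hcl := UltraNoeth.clDim_eq_pseudoDim hπ hmax
  have hcata := UltraNoeth.pseudoDim_eq_cataDim hmax.fg
  refine ⟨h, hh, ?_, ?_, hfr, ?_, hcl, hcata, ?_⟩
  · rw [hpi]
    exact UltraNoeth.depth_le hπ hh
  · rw [hpi, hfr]
  · rw [hcl, WithBot.coe_le_coe]
    exact UltraNoeth.le_pseudoDim hπ hmax hh
  · rw [← hcata, WithBot.coe_le_coe]
    exact UltraNoeth.pseudoDim_le_embDim hmax.fg
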